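/- Let $w_1,w_2,w_3\in\mathbb{P}^1$ be pairwise distinct points of the complex projective line and let $n_1,n_2,n_3\ge 1$ be integers with $\frac1{n_1}+\frac1{n_2}+\frac1{n_3}=1$. Let $X=\mathbb{P}^1_{n_1,n_2,n_3}$ be the elliptic orbi-sphere with underlying Riemann surface $|X|=\mathbb{P}^1$ and with a cone point of order $n_j$ at each $w_j$. Let $(\mathbb{P}^1,\boldsymbol z,\boldsymbol m)$ be the orbi-sphere with cone points of orders $m_1,m_2,m_3\ge 1$ at pairwise distinct marked points $z_1,z_2,z_3$ (order $1$ meaning a smooth point). A uniformizing chart around a point $p$ of order $m$ is a disc $V\subset\mathbb{C}$ centred at $0$, on which the group $\mu_m$ of $m$-th roots of unity acts by multiplication, with the projection $v\mapsto v^m$ followed by the inverse of a holomorphic coordinate centred at $p$; its image contains no cone point except possibly $p$. Let $u\colon(\mathbb{P}^1,\boldsymbol z,\boldsymbol m)\to X$ be a non-constant holomorphic orbifold map, i.e. a holomorphic map $\mathbb{P}^1\to\mathbb{P}^1$ which around every point $p$ has a holomorphic lifting between uniformizing charts around $p$ and $u(p)$ that is equivariant with respect to an injective homomorphism $\lambda_p$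 of the isotropy groups. Let $u$ be of type $(X_{(g_1)},X_{(g_2)},X_{(g_3)})$, a triple of twisted sectors of $X$: each $g_i$ is a nontrivial element of the isotropy group of $X$ at $u(z_i)$ and $g_i=\lambda_{z_i}(e^{2\pi\sqrt{-1}/m_i})$. Let the age $\iota_{(g_i)}\in(0,1)$ be the number for which $g_i$ acts on the uniformizing chart as multiplication by $e^{2\pi\sqrt{-1}\,\iota_{(g_i)}}$. Suppose that $$\sum_{i=1}^{3}\iota_{(g_i)}=1\qquad\text{and}\qquad \iota_{(g_i)}^{-1}\in\mathbb{Z}\quad(i=1,2,3).$$ Then $u$ is an orbifold covering map $(\mathbb{P}^1,\boldsymbol z,\boldsymbol m)\to X$: it is continuous and surjective, and every $y\in|X|$ has a uniformizing chart $\widetilde U\to\widetilde U/G_y$ such that every $x\in u^{-1}(y)$ has a uniformizing chart $\widetilde U\to\widetilde U/G_x$ on the same disc $\widetilde U$, with $G_x\le G_y$, in which $u$ is the natural projection $\widetilde U/G_x\to\widetilde U/G_y$. -/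

import Mathlib

open scoped Manifold Topology OnePoint

noncomputable section

/-! ### The Riemann sphere as a complex manifold -/

/-- The complex projective line, as the one-point compactification of `ℂ`. -/
abbrev RiemannSphere : Type := OnePoint ℂ

namespace RiemannSphere

/-- The involution `z ↦ 1 / z` of the sphere (exchanging `0` and `∞`). -/
def inv : RiemannSphere → RiemannSphere
  | ∞ => ((0 : ℂ) : OnePoint ℂ)
  | some z => if z = 0 then ∞ else ((z⁻¹ : ℂ) : OnePoint ℂ)

@[simp] theorem inv_infty : inv ∞ = ((0 : ℂ) : OnePoint ℂ) := rfl

theorem inv_coe (z : ℂ) :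
    inv (z : OnePoint ℂ) = if z = 0 then ∞ else ((z⁻¹ : ℂ) : OnePoint ℂ) := rfl

@[simp] theorem inv_zero : inv ((0 : ℂ) : OnePoint ℂ) = ∞ := by simp [inv_coe]

theorem inv_coe_of_ne {z : ℂ} (hz : z ≠ 0) :
    inv (z : OnePoint ℂ) = ((z⁻¹ : ℂ) : OnePoint ℂ) := by simp [inv_coe, hz]

theorem inv_inv (p : RiemannSphere) : inv (inv p) = p := by
  induction p using OnePoint.rec with
  | infty => simp
  | coe z =>
    by_cases hz : z = 0
    · simp [hz]
    · rw [inv_coe_of_ne hz, inv_coe_of_ne (inv_ne_zero hz), _root_.inv_inv]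

theorem continuous_inv : Continuous inv := by
  rw [OnePoint.continuous_iff]
  constructor
  · rw [inv_infty, Filter.coclosedCompact_eq_cocompact, ← Metric.cobounded_eq_cocompact]
    have h := (OnePoint.continuous_coe (X := ℂ)).continuousAt (x := 0) |>.tendsto.comp
      (Filter.tendsto_inv₀_cobounded (α := ℂ))
    refine h.congr' ?_
    filter_upwards [Bornology.eventually_ne_cobounded (0 : ℂ)] with z hz
    simp [inv_coe_of_ne hz]
  · rw [continuous_iff_continuousAt]
    intro z
    by_cases hz : z = 0
    · subst hz
      rw [← continuousWithinAt_compl_self, ContinuousWithinAt, inv_zero]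
      have h := (OnePoint.tendsto_coe_infty (X := ℂ))
      rw [Filter.coclosedCompact_eq_cocompact, ← Metric.cobounded_eq_cocompact] at h
      refine (h.comp (Filter.tendsto_inv₀_nhdsNE_zero (α := ℂ))).congr' ?_
      filter_upwards [self_mem_nhdsWithin] with w hw
      exact (inv_coe_of_ne hw).symm
    · have h : ContinuousAt (fun w : ℂ => ((w⁻¹ : ℂ) : OnePoint ℂ)) z :=
        (OnePoint.continuous_coe (X := ℂ)).continuousAt.comp (continuousAt_inv₀ hz)
      refine h.congr ?_
      filter_upwards [isOpen_ne.mem_nhds hz] with w hw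
      exact (inv_coe_of_ne hw).symm

/-- The involution `z ↦ 1 / z` as a homeomorphism. -/
def invHomeomorph : RiemannSphere ≃ₜ RiemannSphere where
  toFun := inv
  invFun := inv
  left_inv := inv_inv
  right_inv := inv_inv
  continuous_toFun := continuous_inv
  continuous_invFun := continuous_inv

/-- The affine coordinate `z` on the complement of `∞`. -/
def affineChart : OpenPartialHomeomorph RiemannSphere ℂ :=
  ((OnePoint.isOpenEmbedding_coe (X := ℂ)).toOpenPartialHomeomorph _).symm

/-- The coordinate `1 / z` on the complement of `0`. -/
def inftyChart : OpenPartialHomeomorph RiemannSphere ℂ :=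
  invHomeomorph.toOpenPartialHomeomorph.trans affineChart

@[simp] theorem affineChart_source : affineChart.source = {∞}ᶜ := by
  simpa [affineChart] using (OnePoint.compl_infty (X := ℂ)).symm

@[simp] theorem affineChart_target : affineChart.target = Set.univ := by
  simp [affineChart]

@[simp] theorem affineChart_symm_apply (z : ℂ) : affineChart.symm z = (z : OnePoint ℂ) := rfl

@[simp] theorem affineChart_coe (z : ℂ) : affineChart (z : OnePoint ℂ) = z := by
  rw [← affineChart_symm_apply]
  exact affineChart.right_inv (by simp)

@[simp] theorem inftyChart_apply (p : RiemannSphere) :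
    inftyChart p = affineChart (inv p) := rfl

@[simp] theorem inftyChart_symm_apply (z : ℂ) :
    inftyChart.symm z = inv (z : OnePoint ℂ) := rfl

theorem mem_inftyChart_source {p : RiemannSphere} :
    p ∈ inftyChart.source ↔ p ≠ ((0 : ℂ) : OnePoint ℂ) := by
  have h : p ∈ inftyChart.source ↔ inv p ≠ ∞ := by
    simp [inftyChart, invHomeomorph]
  rw [h, not_iff_not]
  constructor
  · intro hp
    rw [← inv_inv p, hp, inv_infty]
  · rintro rfl
    simp

@[simp] theorem inftyChart_target : inftyChart.target = Set.univ := by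
  simp [inftyChart]

open Classical in
instance : ChartedSpace ℂ RiemannSphere where
  atlas := {affineChart, inftyChart}
  chartAt p := if p = ∞ then inftyChart else affineChart
  mem_chart_source p := by
    by_cases hp : p = ∞
    · subst hp
      simp [mem_inftyChart_source]
    · simp [hp]
  chart_mem_atlas p := by
    by_cases hp : p = ∞ <;> simp [hp]

theorem transition_apply (z : ℂ) : affineChart (inv (z : OnePoint ℂ)) = z⁻¹ ∨ z = 0 := by
  by_cases hz : z = 0
  · exact Or.inr hz
  · left
    rw [inv_coe_of_ne hz, affineChart_coe]

theorem contDiffOn_transition {s : Set ℂ} (hs : ∀ z ∈ s, z ≠ 0) :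
    ContDiffOn ℂ (⊤ : WithTop ENat) (fun z : ℂ => affineChart (inv (z : OnePoint ℂ))) s := by
  have h : ContDiffOn ℂ (⊤ : WithTop ENat) (fun z : ℂ => z⁻¹) s := fun z hz =>
    (contDiffAt_inv ℂ (hs z hz)).contDiffWithinAt
  refine h.congr fun z hz => ?_
  exact (transition_apply z).resolve_right (hs z hz)

/-- The sphere is a complex-analytic manifold (the order of smoothness `⊤` means analytic). -/
instance : IsManifold 𝓘(ℂ) (⊤ : WithTop ENat) RiemannSphere := by
  refine isManifold_of_contDiffOn _ _ _ ?_
  rintro e e' (rfl | rfl) (rfl | rfl)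
  · refine (contDiffOn_id (𝕜 := ℂ)).congr ?_
    intro z _
    simp
  · refine contDiffOn_transition ?_
    intro z hz h0
    subst h0
    simp [mem_inftyChart_source] at hz
  · refine contDiffOn_transition ?_
    intro z hz h0
    subst h0
    simp at hz
  · refine (contDiffOn_id (𝕜 := ℂ)).congr ?_
    intro z _
    simp [inv_inv]

end RiemannSphere

/-! ### Orbi-Riemann surfaces -/

/-- An orbifold structure on a Riemann surface `S` with finitely many cone points: it is determined
by the orders of the (cyclic) isotropy groups.  Its uniformizing charts are given by
`OrbiSurface.Chart`. -/
structure OrbiSurface (S : Type) where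
  /-- The order of the isotropy group of a point. -/
  order : S → ℕ
  order_pos : ∀ p, 0 < order p
  finite_singular : {p | order p ≠ 1}.Finite

open Classical in
/-- The Riemann sphere with cone points of orders `m i` at the marked points `z i` (a marked point
of order `1` is a smooth point). For pairwise distinct `z i`, see `orbiSphere_order_apply`. -/
def orbiSphere {k : ℕ} (z : Fin k → RiemannSphere) (m : Fin k → ℕ) (hm : ∀ i, 1 ≤ m i) :
    OrbiSurface RiemannSphere where
  order p := ∏ i : Fin k, if z i = p then m i else 1
  order_pos p := Finset.prod_pos fun i _ => by
    split_ifs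
    · exact hm i
    · exact one_pos
  finite_singular := by
    refine (Set.finite_range z).subset fun p hp => ?_
    by_contra h
    refine hp (Finset.prod_eq_one fun i _ => ?_)
    rw [if_neg]
    rintro rfl
    exact h ⟨i, rfl⟩

theorem orbiSphere_order_apply {k : ℕ} {z : Fin k → RiemannSphere} (hz : Function.Injective z)
    (m : Fin k → ℕ) (hm : ∀ i, 1 ≤ m i) (i : Fin k) :
    (orbiSphere z m hm).order (z i) = m i := by
  simp [orbiSphere, hz.eq_iff]

theorem orbiSphere_order_of_notMem {k : ℕ} {z : Fin k → RiemannSphere} (m : Fin k → ℕ)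
    (hm : ∀ i, 1 ≤ m i) {p : RiemannSphere} (hp : ∀ i, z i ≠ p) :
    (orbiSphere z m hm).order p = 1 := by
  simp [orbiSphere, hp]

namespace OrbiSurface

section

variable {S : Type} [TopologicalSpace S] [ChartedSpace ℂ S]

/-- A local uniformizing chart of `X` around `p`: a disc `V = {v : |v| < r}` on which the isotropy
group of `p`, the group of roots of unity of order `m = X.order p`, acts by multiplication,
and the map `V → S`, `v ↦ coord⁻¹ (v ^ m)`, where `coord` is a holomorphic
coordinate centred at `p` with values in the disc of radius `r ^ m`. So `V / μ_m` is identified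
with the neighbourhood `coord.source` of `p`, which contains no cone point except possibly `p`. -/
structure Chart (X : OrbiSurface S) (p : S) where
  radius : ℝ
  radius_pos : 0 < radius
  coord : OpenPartialHomeomorph S ℂ
  /-- The coordinate and its inverse are holomorphic. -/
  holomorphic : coord.MDifferentiable 𝓘(ℂ) 𝓘(ℂ)
  mem_source : p ∈ coord.source
  coord_center : coord p = 0
  target_eq : coord.target = Metric.ball 0 (radius ^ X.order p)
  order_eq_one : ∀ q ∈ coord.source, q ≠ p → X.order q = 1

/-- The uniformizing disc. -/
def Chart.disc {X : OrbiSurface S} {p : S} (c : X.Chart p) : Set ℂ := Metric.ball 0 c.radius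

/-- The uniformizing map from the disc to the surface. -/
def Chart.proj {X : OrbiSurface S} {p : S} (c : X.Chart p) (v : ℂ) : S :=
  c.coord.symm (v ^ X.order p)

end

/-- The isotropy group of `p`, acting on uniformizing discs around `p` by multiplication. -/
abbrev isotropy {S : Type} (X : OrbiSurface S) (p : S) : Subgroup ℂˣ := rootsOfUnity (X.order p) ℂ

/-- The positive generator of the isotropy group of `p`: the rotation by the angle `2π / m`, where
`m` is the order of the group. -/
def generator {S : Type} (X : OrbiSurface S) (p : S) : X.isotropy p :=
  haveI : NeZero (X.order p) := ⟨(X.order_pos p).ne'⟩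
  (Complex.isPrimitiveRoot_exp (X.order p) (X.order_pos p).ne').toRootsOfUnity

theorem generator_coe {S : Type} (X : OrbiSurface S) (p : S) :
    ((X.generator p : ℂˣ) : ℂ) = Complex.exp (2 * Real.pi * Complex.I / X.order p) := rfl

end OrbiSurface

/-! ### Holomorphic orbifold maps, twisted sectors, orbifold coverings -/

section

variable {S T : Type} [TopologicalSpace S] [ChartedSpace ℂ S] [TopologicalSpace T]
  [ChartedSpace ℂ T]

/-- A local lifting of `f` at `p`: a holomorphic map between uniformizing discs around `p` and
`f p` covering `f`, equivariant with respect to an injective homomorphism of isotropy groups. -/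
structure LocalLift (X : OrbiSurface S) (Y : OrbiSurface T) (f : S → T) (p : S) where
  source : X.Chart p
  target : Y.Chart (f p)
  hom : X.isotropy p →* Y.isotropy (f p)
  hom_injective : Function.Injective hom
  lift : ℂ → ℂ
  lift_holomorphic : DifferentiableOn ℂ lift source.disc
  lift_mapsTo : Set.MapsTo lift source.disc target.disc
  lift_equivariant : ∀ (g : X.isotropy p), ∀ v ∈ source.disc,
    lift (((g : ℂˣ) : ℂ) * v) = ((hom g : ℂˣ) : ℂ) * lift v
  proj_lift : ∀ v ∈ source.disc, target.proj (lift v) = f (source.proj v)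

/-- `f` is a holomorphic orbifold map: it is holomorphic between the underlying Riemann surfaces
and it has a local lifting at every point. -/
def IsHolomorphicOrbiMap (X : OrbiSurface S) (Y : OrbiSurface T) (f : S → T) : Prop :=
  MDifferentiable 𝓘(ℂ) 𝓘(ℂ) f ∧ ∀ p, Nonempty (LocalLift X Y f p)

/-- A twisted sector of `Y`: a point `w` with a nontrivial element `g` of its isotropy group. (The
isotropy groups are abelian and the cone points are isolated, so this is the same as a component
of the inertia orbifold other than the untwisted one.) -/
structure TwistedSector (Y : OrbiSurface T) where
  point : T
  elt : Y.isotropy point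
  elt_ne_one : elt ≠ 1

/-- The age of a twisted sector: the unique `ι ∈ [0, 1)` such that `g` acts on the uniformizing disc
as multiplication by `exp (2 π i ι)`. -/
def TwistedSector.age {Y : OrbiSurface T} (s : TwistedSector Y) : ℝ :=
  Int.fract (Complex.arg ((s.elt : ℂˣ) : ℂ) / (2 * Real.pi))

/-- The orbifold map `f` has the twisted sector `s` as its insertion at the point `p`: `f` maps `p`
to the point of `s`, and the homomorphism of isotropy groups at `p` maps the positive generator
to the group element of `s`. -/
def HasInsertion (X : OrbiSurface S) (Y : OrbiSurface T) (f : S → T) (p : S)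
    (s : TwistedSector Y) : Prop :=
  f p = s.point ∧
    ∃ L : LocalLift X Y f p, ((L.hom (X.generator p) : ℂˣ) : ℂ) = ((s.elt : ℂˣ) : ℂ)

/-- `f` is an orbifold covering: it is continuous and surjective, and every `y` has a uniformizing
chart `D → D / G_y` such that each `x` in the fibre of `y` has a uniformizing chart
`D → D / G_x` on the same disc `D`, with `G_x ≤ G_y`, for which `f` is the natural projection
`D / G_x → D / G_y`. -/
def IsOrbifoldCovering (X : OrbiSurface S) (Y : OrbiSurface T) (f : S → T) : Prop :=
  Continuous f ∧ Function.Surjective f ∧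
    ∀ y : T, ∃ c : Y.Chart y, ∀ x : S, f x = y →
      X.isotropy x ≤ Y.isotropy y ∧
      ∃ c' : X.Chart x, c'.radius = c.radius ∧ ∀ v ∈ c'.disc, f (c'.proj v) = c.proj v

end

end

/-! Let e be the ramification index of u at p, d the degree of u, and m and n the isotropy orders at
p and u(p). A local lift satisfies lift(v)^n = G(v^m), where G is u in coordinates. Comparing
vanishing orders at 0 shows that n divides e·m, so e/n ≥ 1/m (`LocalLift.exists_order_mul_eq`).
Since the homomorphisms of isotropy groups are injective, the i-th insertion has order m_i. An age
with integral inverse is 1 over the order of the element (`TwistedSector.age_eq_one_div`), so total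
age 1 means Σ 1/m_i = 1: both orbifolds have Euler characteristic zero.

Riemann-Hurwitz then leaves no room. Over a finite set containing the marked points and the fibres
of the cone points, Σ(e/n − 1/m) = Σ(e−1) − Σ e(1−1/n) + Σ(1−1/m) ≤ (2d−2) − 2d + 2 = 0, while every
term is nonnegative. Hence e·m = n at every point (`IsRationalMap.ramification_mul_order_eq`). In a
suitable coordinate u is an e-th power, so v^m is sent to v^n, which is the natural projection
(`OrbiSurface.exists_chart_eq_proj`). Fibres are finite, so one disc serves a whole fibre.

Only the inequality Σ(e−1) ≤ 2d−2 is needed, and it is algebraic. Write u = [P : Q] with coprime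
polynomials (`exists_isRationalMap`); ramification forces zeros of the Wronskian of P and Q, whose
degree is bounded (`sum_ramification_sub_one_le`). `IsRationalMap.analyticOrderAt_coord` identifies
the algebraic index with the vanishing order in coordinates. -/

noncomputable section

/-! ### Rational maps: degree, ramification and the Riemann-Hurwitz inequality. -/

namespace RiemannSphere

open Polynomial

/-- The point `[a : b]` of the sphere. -/
def ofHomogeneous (a b : ℂ) : RiemannSphere := if b = 0 then ∞ else ((a / b : ℂ) : OnePoint ℂ)

/-- The polynomial whose finite roots are the finite points of the fibre of `[P : Q]`. -/
def fiberPoly (P Q : ℂ[X]) : RiemannSphere → ℂ[X]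
  | ∞ => Q
  | some a => P - C a * Q

@[simp] theorem fiberPoly_infty (P Q : ℂ[X]) : fiberPoly P Q ∞ = Q := rfl

@[simp] theorem fiberPoly_coe (P Q : ℂ[X]) (a : ℂ) :
    fiberPoly P Q (a : OnePoint ℂ) = P - C a * Q := rfl

theorem ofHomogeneous_eq_iff {P Q : ℂ[X]} {x : ℂ} (h : P.eval x ≠ 0 ∨ Q.eval x ≠ 0)
    (w : RiemannSphere) :
    ofHomogeneous (P.eval x) (Q.eval x) = w ↔ (fiberPoly P Q w).eval x = 0 := by
  unfold ofHomogeneous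
  induction w using OnePoint.rec with
  | infty => by_cases hb : Q.eval x = 0 <;> simp [hb]
  | coe a =>
    by_cases hb : Q.eval x = 0
    · simpa [hb] using h
    · simp [hb, div_eq_iff hb, sub_eq_zero]

/-- The degree of the map `[P : Q]` for coprime `P` and `Q`. -/
def mapDegree (P Q : ℂ[X]) : ℕ := max P.natDegree Q.natDegree

/-- The map `u` is given by the coprime polynomials `P` and `Q`, not both constant. -/
structure IsRationalMap (u : RiemannSphere → RiemannSphere) (P Q : ℂ[X]) : Prop where
  coprime : IsCoprime P Q
  pos : 0 < mapDegree P Q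
  apply_coe : ∀ x : ℂ, u (x : OnePoint ℂ) = ofHomogeneous (P.eval x) (Q.eval x)
  apply_inv : ∀ t : ℂ, u (inv (t : OnePoint ℂ)) =
    ofHomogeneous ((P.reflect (mapDegree P Q)).eval t) ((Q.reflect (mapDegree P Q)).eval t)

/-- The ramification index of `u = [P : Q]` at a point. -/
def ramification (u : RiemannSphere → RiemannSphere) (P Q : ℂ[X]) : RiemannSphere → ℕ
  | ∞ => mapDegree P Q - (fiberPoly P Q (u ∞)).natDegree
  | some x => (fiberPoly P Q (u (x : OnePoint ℂ))).rootMultiplicity x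

theorem ramification_infty (u : RiemannSphere → RiemannSphere) (P Q : ℂ[X]) :
    ramification u P Q ∞ = mapDegree P Q - (fiberPoly P Q (u ∞)).natDegree := rfl

theorem ramification_coe (u : RiemannSphere → RiemannSphere) (P Q : ℂ[X]) (x : ℂ) :
    ramification u P Q (x : OnePoint ℂ) =
      (fiberPoly P Q (u (x : OnePoint ℂ))).rootMultiplicity x := rfl

theorem natDegree_fiberPoly_le (P Q : ℂ[X]) (w : RiemannSphere) :
    (fiberPoly P Q w).natDegree ≤ mapDegree P Q := by
  induction w using OnePoint.rec with
  | infty => exact le_max_right _ _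
  | coe a =>
    refine (natDegree_sub_le _ _).trans (max_le_max le_rfl ?_)
    exact natDegree_C_mul_le _ _

theorem eval_ne_zero_or {P Q : ℂ[X]} (h : IsCoprime P Q) (x : ℂ) :
    P.eval x ≠ 0 ∨ Q.eval x ≠ 0 := by
  by_contra! hc
  obtain ⟨a, b, hab⟩ := h
  simpa [hc.1, hc.2] using congrArg (eval x) hab

theorem fiberPoly_reflect (P Q : ℂ[X]) (N : ℕ) (w : RiemannSphere) :
    fiberPoly (P.reflect N) (Q.reflect N) w = (fiberPoly P Q w).reflect N := by
  induction w using OnePoint.rec with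
  | infty => rfl
  | coe a => simp [reflect_sub, reflect_C_mul]

theorem eval_zero_reflect (P : ℂ[X]) (N : ℕ) : (P.reflect N).eval 0 = P.coeff N := by
  rw [← coeff_zero_eq_eval_zero, coeff_reflect, revAt_zero]

/-- At t = 0 the values are the coefficients of degree max(deg P, deg Q), one of which is a leading
coefficient. For t ≠ 0 the zeros correspond to those of P and Q at 1/t. -/
theorem reflect_eval_ne_zero_or {P Q : ℂ[X]} (hc : IsCoprime P Q) (hp : 0 < mapDegree P Q) (t : ℂ) :
    (P.reflect (mapDegree P Q)).eval t ≠ 0 ∨ (Q.reflect (mapDegree P Q)).eval t ≠ 0 := by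
  by_cases ht : t = 0
  · subst ht
    rw [eval_zero_reflect, eval_zero_reflect]
    unfold mapDegree at *
    rcases le_total P.natDegree Q.natDegree with hle | hle
    · right
      rw [max_eq_right hle] at hp ⊢
      intro h0
      rw [coeff_natDegree, leadingCoeff_eq_zero] at h0
      simp [h0] at hp
    · left
      rw [max_eq_left hle] at hp ⊢
      intro h0
      rw [coeff_natDegree, leadingCoeff_eq_zero] at h0
      simp [h0] at hp
  · let _ : Invertible t := invertibleOfNonzero ht
    let _ : Invertible t⁻¹ := invertibleOfNonzero (inv_ne_zero ht)
    have key : ∀ R : ℂ[X], R.natDegree ≤ mapDegree P Q →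
        ((R.reflect (mapDegree P Q)).eval t = 0 ↔ R.eval t⁻¹ = 0) := by
      intro R hR
      have := eval₂_reflect_eq_zero_iff (RingHom.id ℂ) t⁻¹ (mapDegree P Q) R hR
      rwa [invOf_eq_inv, _root_.inv_inv] at this
    rw [Ne, key P (le_max_left _ _), Ne, key Q (le_max_right _ _)]
    exact eval_ne_zero_or hc _

namespace IsRationalMap

variable {u : RiemannSphere → RiemannSphere} {P Q : ℂ[X]} (h : IsRationalMap u P Q)
include h

theorem not_isUnit : ¬ (P.natDegree = 0 ∧ Q.natDegree = 0) := by
  rintro ⟨h1, h2⟩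
  simpa [mapDegree, h1, h2] using h.pos

theorem fiberPoly_ne_zero (w : RiemannSphere) : fiberPoly P Q w ≠ 0 := by
  intro h0
  induction w using OnePoint.rec with
  | infty =>
    rw [fiberPoly_infty] at h0
    have hc := h.coprime
    rw [h0, isCoprime_zero_right] at hc
    exact h.not_isUnit ⟨natDegree_eq_zero_of_isUnit hc, by simp [h0]⟩
  | coe a =>
    rw [fiberPoly_coe, sub_eq_zero] at h0
    have hc := h.coprime
    have hQ : IsUnit Q := by
      rw [h0] at hc
      exact hc.isUnit_of_dvd' (Dvd.intro_left _ rfl) dvd_rfl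
    have hQd := natDegree_eq_zero_of_isUnit hQ
    refine h.not_isUnit ⟨?_, hQd⟩
    rw [h0]
    have := natDegree_C_mul_le a Q
    omega

theorem apply_coe_eq_iff (x : ℂ) (w : RiemannSphere) :
    u (x : OnePoint ℂ) = w ↔ (fiberPoly P Q w).eval x = 0 := by
  rw [h.apply_coe]
  exact ofHomogeneous_eq_iff (eval_ne_zero_or h.coprime x) w

/-- In the coordinate 1/z the fibre polynomial becomes its reflection, whose value at 0 is the
coefficient of top degree d. So a drop in degree counts the zeros at infinity. -/
theorem apply_infty_eq_iff (w : RiemannSphere) :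
    u ∞ = w ↔ (fiberPoly P Q w).natDegree < mapDegree P Q := by
  have h1 := h.apply_inv 0
  rw [inv_zero] at h1
  rw [h1, ofHomogeneous_eq_iff (reflect_eval_ne_zero_or h.coprime h.pos 0), fiberPoly_reflect,
    eval_zero_reflect]
  constructor
  · intro h0
    refine lt_of_le_of_ne (natDegree_fiberPoly_le P Q w) fun he => ?_
    rw [← he, coeff_natDegree, leadingCoeff_eq_zero] at h0
    exact h.fiberPoly_ne_zero w h0
  · exact coeff_eq_zero_of_natDegree_lt

theorem one_le_ramification (p : RiemannSphere) : 1 ≤ ramification u P Q p := by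
  induction p using OnePoint.rec with
  | infty =>
    rw [ramification_infty]
    have := (h.apply_infty_eq_iff _).1 rfl
    omega
  | coe x =>
    rw [ramification_coe, Nat.one_le_iff_ne_zero]
    exact ((rootMultiplicity_pos (h.fiberPoly_ne_zero _)).2 ((h.apply_coe_eq_iff x _).1 rfl)).ne'

open Classical in
/-- The points of a fibre, counted with multiplicity. -/
theorem sum_ramification_fiber (w : RiemannSphere) :
    ∃ T : Finset RiemannSphere, (∀ p, p ∈ T ↔ u p = w) ∧
      ∑ p ∈ T, ramification u P Q p = mapDegree P Q := by
  set R := fiberPoly P Q w with hR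
  have hR0 : R ≠ 0 := h.fiberPoly_ne_zero w
  let F : Finset RiemannSphere := R.roots.toFinset.map ⟨((↑) : ℂ → OnePoint ℂ),
    OnePoint.coe_injective⟩
  have hF : ∑ p ∈ F, ramification u P Q p = R.natDegree := by
    rw [Finset.sum_map, ← (IsAlgClosed.splits R).natDegree_eq_card_roots.symm,
      ← Multiset.toFinset_sum_count_eq]
    refine Finset.sum_congr rfl fun x hx => ?_
    rw [Multiset.mem_toFinset, mem_roots hR0, IsRoot.def, ← h.apply_coe_eq_iff] at hx
    simp only [Function.Embedding.coeFn_mk, ramification_coe, count_roots]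
    rw [hx]
  have hmem : ∀ x : ℂ, (x : OnePoint ℂ) ∈ F ↔ u (x : OnePoint ℂ) = w := by
    intro x
    simp [F, h.apply_coe_eq_iff, hR0, ← hR]
  have hinf : (∞ : RiemannSphere) ∉ F := by simp [F]
  -- The finite points contribute deg R. The missing d − deg R is the index at infinity if infinity
  -- lies in the fibre, and is zero otherwise.
  by_cases hw : u ∞ = w
  · refine ⟨insert ∞ F, fun p => ?_, ?_⟩
    · induction p using OnePoint.rec with
      | infty => simp [hw]
      | coe x => simp [hmem]
    · rw [Finset.sum_insert hinf, hF, ramification_infty, hw, hR]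
      have := natDegree_fiberPoly_le P Q w
      omega
  · refine ⟨F, fun p => ?_, ?_⟩
    · induction p using OnePoint.rec with
      | infty => simp [hw, hinf]
      | coe x => exact hmem x
    · rw [hF, hR]
      rw [h.apply_infty_eq_iff] at hw
      have := natDegree_fiberPoly_le P Q w
      omega

theorem wronskian_ne_zero : wronskian P Q ≠ 0 := by
  rw [Ne, h.coprime.wronskian_eq_zero_iff]
  rintro ⟨h1, h2⟩
  exact h.not_isUnit ⟨derivative_eq_zero.1 h1,
    derivative_eq_zero.1 h2⟩

-- The Wronskian is alternating and bilinear, so P may be replaced by P − aQ, or the pair by (Q,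
-- −P). The degree bound serves the estimate at infinity.
omit h in
theorem exists_wronskian_eq (P Q : ℂ[X]) (w : RiemannSphere) :
    ∃ S : ℂ[X], S.natDegree ≤ mapDegree P Q ∧ wronskian P Q = wronskian (fiberPoly P Q w) S := by
  induction w using OnePoint.rec with
  | infty =>
    refine ⟨-P, by simp [mapDegree], ?_⟩
    rw [wronskian_neg_right, wronskian_neg_eq, fiberPoly_infty]
  | coe a =>
    refine ⟨Q, le_max_right _ _, ?_⟩
    simp only [wronskian, fiberPoly_coe, derivative_sub, derivative_mul, derivative_C]
    ring

/-- A root of order e of the fibre polynomial is a root of order at least e − 1 of its derivative,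
hence of each term of the Wronskian formed with it. -/
theorem ramification_sub_one_le (x : ℂ) :
    ramification u P Q (x : OnePoint ℂ) - 1 ≤ (wronskian P Q).rootMultiplicity x := by
  rw [le_rootMultiplicity_iff h.wronskian_ne_zero, ramification_coe]
  obtain ⟨S, -, hS⟩ := exists_wronskian_eq P Q (u (x : OnePoint ℂ))
  rw [hS, wronskian]
  have hd := pow_rootMultiplicity_dvd (fiberPoly P Q (u (x : OnePoint ℂ))) x
  refine dvd_sub (Dvd.dvd.mul_right ?_ _) (Dvd.dvd.mul_right ?_ _)
  · exact (pow_dvd_pow _ (Nat.sub_le _ _)).trans hd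
  · exact pow_sub_one_dvd_derivative_of_pow_dvd hd

open Classical in
/-- The inequality half of the Riemann-Hurwitz formula. -/
theorem sum_ramification_sub_one_le (S : Finset RiemannSphere) :
    ∑ p ∈ S, (ramification u P Q p - 1) + 2 ≤ 2 * mapDegree P Q := by
  set W := wronskian P Q with hW
  obtain ⟨T, hT, hWT⟩ := exists_wronskian_eq P Q (u ∞)
  -- The fibre polynomial at u(∞) has degree d − e_∞ and its partner degree at most d; the strict
  -- bound on the degree of a Wronskian gives the extra 1.
  have hdeg : W.natDegree + ramification u P Q ∞ + 1 ≤ 2 * mapDegree P Q := by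
    have h1 : wronskian (fiberPoly P Q (u ∞)) T ≠ 0 := hWT ▸ h.wronskian_ne_zero
    have h2 := natDegree_wronskian_lt_add h1
    rw [← hWT, ← hW] at h2
    rw [ramification_infty]
    have := natDegree_fiberPoly_le P Q (u ∞)
    omega
  let S' : Finset ℂ := S.preimage ((↑) : ℂ → OnePoint ℂ) OnePoint.coe_injective.injOn
  have hfin : ∑ x ∈ S', (ramification u P Q (x : OnePoint ℂ) - 1) ≤ W.natDegree := by
    calc ∑ x ∈ S', (ramification u P Q (x : OnePoint ℂ) - 1)
        ≤ ∑ x ∈ S', W.roots.count x := by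
          refine Finset.sum_le_sum fun x _ => ?_
          rw [count_roots]
          exact h.ramification_sub_one_le x
      _ ≤ ∑ x ∈ S' ∪ W.roots.toFinset, W.roots.count x :=
          Finset.sum_le_sum_of_subset Finset.subset_union_left
      _ = W.roots.card := Multiset.sum_count_eq_card fun x hx => by simp_all
      _ ≤ W.natDegree := card_roots' W
  have hsub : S ⊆ insert ∞ (S'.map ⟨((↑) : ℂ → OnePoint ℂ), OnePoint.coe_injective⟩) := by
    intro p hp
    induction p using OnePoint.rec with
    | infty => simp
    | coe x => simpa [S'] using hp
  have h1 := Finset.sum_le_sum_of_subset (f := fun p => ramification u P Q p - 1) hsub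
  rw [Finset.sum_insert (by simp), Finset.sum_map] at h1
  simp only [Function.Embedding.coeFn_mk] at h1
  have := h.one_le_ramification ∞
  omega

end IsRationalMap

end RiemannSphere

/-! ### Holomorphic self-maps of the sphere are rational. -/

/-- An entire function with at most a pole at infinity is a polynomial. -/
theorem Differentiable.exists_eq_polynomial_eval {g : ℂ → ℂ} (hg : Differentiable ℂ g)
    (hinf : MeromorphicAt (fun t => g t⁻¹) 0) :
    ∃ P : Polynomial ℂ, ∀ z, g z = P.eval z := by
  obtain ⟨n, hn⟩ := hinf
  obtain ⟨C, hC⟩ : ∃ C : ℝ, ∀ᶠ t in 𝓝 (0 : ℂ), ‖(t - 0) ^ n • g t⁻¹‖ < C :=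
    ⟨_, hn.continuousAt.norm.eventually_lt continuousAt_const (lt_add_one _)⟩
  obtain ⟨δ, hδ, hball⟩ := Metric.eventually_nhds_iff.1 hC
  have hC0 : 0 < C := (norm_nonneg _).trans_lt (hball (y := 0) (by simpa using hδ))
  have hgrow : ∀ z : ℂ, δ⁻¹ < ‖z‖ → ‖g z‖ ≤ C * ‖z‖ ^ n := by
    intro z hz
    have hz0 : 0 < ‖z‖ := (inv_pos.2 hδ).trans hz
    have h1 := hball (y := z⁻¹) (by
      rw [dist_zero_right, norm_inv]
      exact inv_lt_of_inv_lt₀ hδ hz)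
    rw [sub_zero, _root_.inv_inv, norm_smul, norm_pow, norm_inv, inv_pow,
      inv_mul_lt_iff₀ (pow_pos hz0 n)] at h1
    linarith [h1, mul_comm C (‖z‖ ^ n)]
  -- Cauchy's estimate on the circle of radius R bounds this by a constant times R^(n−k), and so by
  -- a constant over R once R ≥ 1.
  have hzero : ∀ k, n < k → iteratedDeriv k g 0 = 0 := by
    intro k hk
    rw [← norm_le_zero_iff]
    have hlim : Filter.Tendsto (fun R : ℝ => k.factorial * C / R) Filter.atTop (𝓝 0) :=
      tendsto_const_nhds.div_atTop Filter.tendsto_id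
    refine ge_of_tendsto hlim ?_
    filter_upwards [Filter.eventually_gt_atTop δ⁻¹, Filter.eventually_ge_atTop 1] with R hR hR1
    have hR0 : 0 < R := by linarith
    have hle := Complex.norm_iteratedDeriv_le_of_forall_mem_sphere_norm_le (c := 0) (R := R)
      (C := C * R ^ n) k hR0 hg.diffContOnCl fun z hz => by
        have hz' : ‖z‖ = R := by simpa using hz
        have := hgrow z (by rw [hz']; exact hR)
        rwa [hz'] at this
    refine hle.trans ?_
    rw [div_le_div_iff₀ (pow_pos hR0 _) hR0]
    have hp : R ^ n * R ≤ R ^ k := by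
      rw [← pow_succ]
      exact pow_le_pow_right₀ hR1 hk
    calc (k.factorial : ℝ) * (C * R ^ n) * R = k.factorial * C * (R ^ n * R) := by ring
      _ ≤ k.factorial * C * R ^ k := by gcongr
  refine ⟨∑ k ∈ Finset.range (n + 1),
    Polynomial.C ((k.factorial : ℂ)⁻¹ * iteratedDeriv k g 0) * Polynomial.X ^ k, fun z => ?_⟩
  rw [← Complex.taylorSeries_eq_of_entire' 0 z hg, tsum_eq_sum (s := Finset.range (n + 1)),
    Polynomial.eval_finsetSum]
  · simp
  · intro k hk
    rw [hzero k (by simpa using hk)]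
    simp

/-- A function which is meromorphic on the sphere is rational. -/
theorem exists_eq_polynomial_div {f : ℂ → ℂ} (Z : Finset ℂ) (han : ∀ z ∉ Z, AnalyticAt ℂ f z)
    (hmer : ∀ z ∈ Z, MeromorphicAt f z) (hinf : MeromorphicAt (fun t => f t⁻¹) 0) :
    ∃ P Q : Polynomial ℂ, ∀ z ∉ Z, Q.eval z ≠ 0 ∧ f z = P.eval z / Q.eval z := by
  choose! N hN using hmer
  -- The exponents come from the definition of meromorphy, so Q·f is entire; it has at most a pole
  -- at infinity and is therefore a polynomial.
  let Q : Polynomial ℂ := ∏ a ∈ Z, (Polynomial.X - Polynomial.C a) ^ N a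
  have hQ : ∀ z ∉ Z, Q.eval z ≠ 0 := by
    intro z hz
    simp only [Q, Polynomial.eval_prod, Polynomial.eval_pow, Polynomial.eval_sub,
      Polynomial.eval_X, Polynomial.eval_C]
    refine Finset.prod_ne_zero_iff.2 fun a ha => pow_ne_zero _ (sub_ne_zero.2 ?_)
    rintro rfl
    exact hz ha
  have hQan : ∀ (R : Polynomial ℂ) z, AnalyticAt ℂ (fun z => R.eval z) z := fun R z =>
    R.differentiable.analyticAt z
  have hent : Differentiable ℂ fun z => Q.eval z * f z := by
    intro z
    refine AnalyticAt.differentiableAt ?_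
    by_cases hz : z ∈ Z
    · have h1 : (fun y => Q.eval y * f y) = fun y =>
          (∏ a ∈ Z.erase z, (Polynomial.X - Polynomial.C a) ^ N a).eval y *
            ((y - z) ^ N z • f y) := by
        funext y
        simp only [Q]
        rw [← Finset.mul_prod_erase Z _ hz, Polynomial.eval_mul]
        simp only [Polynomial.eval_pow, Polynomial.eval_sub, Polynomial.eval_X,
          Polynomial.eval_C, smul_eq_mul]
        ring
      rw [h1]
      exact (hQan _ z).mul (hN z hz)
    · exact (hQan _ z).mul (han z hz)
  have hQinf : MeromorphicAt (fun t : ℂ => Q.eval t⁻¹) 0 := by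
    simp only [Q, Polynomial.eval_prod, Polynomial.eval_pow, Polynomial.eval_sub,
      Polynomial.eval_X, Polynomial.eval_C]
    refine MeromorphicAt.fun_prod fun a _ => ?_
    exact ((MeromorphicAt.id 0).inv.sub (MeromorphicAt.const a 0)).pow _
  obtain ⟨P, hP⟩ := hent.exists_eq_polynomial_eval (hQinf.mul hinf)
  refine ⟨P, Q, fun z hz => ⟨hQ z hz, ?_⟩⟩
  rw [eq_div_iff (hQ z hz), ← hP, mul_comm]

section

variable {S T : Type} [TopologicalSpace S] [ChartedSpace ℂ S] [TopologicalSpace T]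
  [ChartedSpace ℂ T]

/-- A holomorphic map is analytic in holomorphic coordinates. -/
theorem MDifferentiable.analyticAt_coord {f : S → T} (hf : MDifferentiable 𝓘(ℂ) 𝓘(ℂ) f)
    {ψ : OpenPartialHomeomorph S ℂ} (hψ : ψ.MDifferentiable 𝓘(ℂ) 𝓘(ℂ))
    {φ : OpenPartialHomeomorph T ℂ} (hφ : φ.MDifferentiable 𝓘(ℂ) 𝓘(ℂ)) {t : ℂ}
    (ht : t ∈ ψ.target) (hft : f (ψ.symm t) ∈ φ.source) :
    AnalyticAt ℂ (fun t => φ (f (ψ.symm t))) t := by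
  rw [Complex.analyticAt_iff_eventually_differentiableAt]
  have hc : ContinuousAt (fun t => f (ψ.symm t)) t :=
    hf.continuous.continuousAt.comp (ψ.continuousAt_symm ht)
  filter_upwards [ψ.open_target.mem_nhds ht, hc.preimage_mem_nhds (φ.open_source.mem_nhds hft)]
    with s hs hfs
  rw [← mdifferentiableAt_iff_differentiableAt]
  exact (hφ.mdifferentiableAt hfs).comp s ((hf _).comp s (hψ.mdifferentiableAt_symm hs))

end

namespace RiemannSphere

open Polynomial

theorem chartAt_infty : chartAt ℂ (∞ : RiemannSphere) = inftyChart := if_pos rfl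

theorem chartAt_coe (x : ℂ) : chartAt ℂ (x : RiemannSphere) = affineChart :=
  if_neg (OnePoint.coe_ne_infty x)

theorem mdifferentiable_affineChart : affineChart.MDifferentiable 𝓘(ℂ) 𝓘(ℂ) := by
  have : IsManifold 𝓘(ℂ) 1 RiemannSphere := IsManifold.of_le (n := ⊤) le_top
  rw [← chartAt_coe 0]
  exact mdifferentiable_chart _

theorem mdifferentiable_inftyChart : inftyChart.MDifferentiable 𝓘(ℂ) 𝓘(ℂ) := by
  have : IsManifold 𝓘(ℂ) 1 RiemannSphere := IsManifold.of_le (n := ⊤) le_top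
  rw [← chartAt_infty]
  exact mdifferentiable_chart _

theorem affineChart_inv_eq_zero_iff {p : RiemannSphere} (hp : p ≠ ((0 : ℂ) : OnePoint ℂ)) :
    affineChart (inv p) = 0 ↔ p = ∞ := by
  induction p using OnePoint.rec with
  | infty => simp
  | coe a =>
    have ha : a ≠ 0 := by rintro rfl; exact hp rfl
    simp [inv_coe_of_ne ha, ha]

variable {u : RiemannSphere → RiemannSphere} (hu : MDifferentiable 𝓘(ℂ) 𝓘(ℂ) u)
include hu

/-- The principle of isolated zeros, applied to 1/u in a chart around p. -/
theorem eventually_eq_infty_or (p : RiemannSphere) :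
    (∀ᶠ q in 𝓝 p, u q = ∞) ∨ ∀ᶠ q in 𝓝[≠] p, u q ≠ ∞ := by
  by_cases hp : u p = ∞
  · have hsrc : u p ∈ inftyChart.source := by rw [mem_inftyChart_source, hp]; simp
    set χ := chartAt ℂ p with hχ
    have hpχ : p ∈ χ.source := mem_chart_source ℂ p
    have : IsManifold 𝓘(ℂ) 1 RiemannSphere := IsManifold.of_le (n := ⊤) le_top
    have hχd : χ.MDifferentiable 𝓘(ℂ) 𝓘(ℂ) := mdifferentiable_chart p
    have han := hu.analyticAt_coord hχd mdifferentiable_inftyChart (χ.map_source hpχ)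
      (by rwa [χ.left_inv hpχ])
    have hev : ∀ᶠ q in 𝓝 p, q ∈ χ.source ∧ u q ∈ inftyChart.source :=
      Filter.Eventually.and (χ.open_source.mem_nhds hpχ)
        (hu.continuous.continuousAt.preimage_mem_nhds (inftyChart.open_source.mem_nhds hsrc))
    have key : ∀ᶠ q in 𝓝 p, (inftyChart (u (χ.symm (χ q))) = 0 ↔ u q = ∞) := by
      filter_upwards [hev] with q hq
      rw [χ.left_inv hq.1, inftyChart_apply]
      exact affineChart_inv_eq_zero_iff (mem_inftyChart_source.1 hq.2)
    rcases han.eventually_eq_zero_or_eventually_ne_zero with h | h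
    · left
      filter_upwards [(χ.continuousAt hpχ).eventually h, key] with q h1 h2
      exact h2.1 h1
    · right
      have ht : Filter.Tendsto χ (𝓝[≠] p) (𝓝[≠] (χ p)) := by
        refine tendsto_nhdsWithin_iff.2
          ⟨(χ.continuousAt hpχ).tendsto.mono_left nhdsWithin_le_nhds, ?_⟩
        filter_upwards [self_mem_nhdsWithin, nhdsWithin_le_nhds hev] with q hq hq'
        exact fun heq => hq (χ.injOn hq'.1 hpχ heq)
      filter_upwards [ht.eventually h, nhdsWithin_le_nhds key] with q h1 h2
      exact fun h3 => h1 (h2.2 h3)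
  · right
    exact nhdsWithin_le_nhds (hu.continuous.continuousAt.eventually_ne hp)

/-- The points near which u is identically ∞ form a clopen set. The sphere is connected and u is not
constant, so this set is empty; poles are then isolated, and compactness makes them finite in
number. -/
theorem finite_preimage_infty (hnonconst : ¬ ∃ y, ∀ x, u x = y) : {p | u p = ∞}.Finite := by
  have hclopen : IsClopen {p | ∀ᶠ q in 𝓝 p, u q = ∞} := by
    refine ⟨⟨?_⟩, isOpen_setOfPred_eventually_nhds⟩
    rw [isOpen_iff_mem_nhds]
    intro p hp
    have h1 := (eventually_eq_infty_or hu p).resolve_left hp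
    rw [eventually_nhdsWithin_iff] at h1
    filter_upwards [eventually_eventually_nhds.2 h1] with q hq h2
    have h3 : ∀ᶠ r in 𝓝 q, r = p := by
      filter_upwards [hq, h2] with r hr hr'
      by_contra hne
      exact hr hne hr'
    have hqp : q = p := h3.self_of_nhds
    subst hqp
    exact hp h2
  rcases isClopen_iff.1 hclopen with h | h
  · have hloc : ∀ p, ∀ᶠ q in 𝓝[≠] p, u q ≠ ∞ := fun p =>
      (eventually_eq_infty_or hu p).resolve_left fun hp => by
        have : p ∈ {p | ∀ᶠ q in 𝓝 p, u q = ∞} := hp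
        rw [h] at this
        exact this
    have := isCompact_univ (X := RiemannSphere).induction_on
      (p := fun s => (s ∩ {p | u p = ∞}).Finite) (by simp)
      (fun s t hst ht => ht.subset (Set.inter_subset_inter_left _ hst))
      (fun s t hs ht => by rw [Set.union_inter_distrib_right]; exact hs.union ht)
      (fun p _ => by
        refine ⟨_, nhdsWithin_le_nhds (eventually_nhdsWithin_iff.1 (hloc p)), ?_⟩
        refine (Set.finite_singleton p).subset ?_
        rintro q ⟨h1, h2⟩
        by_contra hne
        exact h1 hne h2)
    simpa using this
  · refine absurd ⟨∞, fun x => ?_⟩ hnonconst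
    have : x ∈ {p | ∀ᶠ q in 𝓝 p, u q = ∞} := by rw [h]; trivial
    exact this.self_of_nhds

theorem meromorphicAt_affineChart_comp (hnonconst : ¬ ∃ y, ∀ x, u x = y)
    {ψ : OpenPartialHomeomorph RiemannSphere ℂ} (hψ : ψ.MDifferentiable 𝓘(ℂ) 𝓘(ℂ)) {t : ℂ}
    (ht : t ∈ ψ.target) : MeromorphicAt (fun t => affineChart (u (ψ.symm t))) t := by
  by_cases hp : u (ψ.symm t) = ∞
  · have h0 : u (ψ.symm t) ≠ ((0 : ℂ) : OnePoint ℂ) := by rw [hp]; simp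
    have han := hu.analyticAt_coord hψ mdifferentiable_inftyChart ht
      (mem_inftyChart_source.2 h0)
    -- Agreement on a punctured neighbourhood suffices, so the junk value of `affineChart` at ∞
    -- plays no role.
    refine han.meromorphicAt.inv.congr ?_
    have hc : ContinuousAt (fun t => u (ψ.symm t)) t :=
      hu.continuous.continuousAt.comp (ψ.continuousAt_symm ht)
    have hfin := (finite_preimage_infty hu hnonconst).subset
      (Set.sdiff_subset (s := {p | u p = ∞}) (t := {ψ.symm t}))
    filter_upwards [nhdsWithin_le_nhds (hc.eventually_ne h0), self_mem_nhdsWithin,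
      nhdsWithin_le_nhds (ψ.open_target.mem_nhds ht), nhdsWithin_le_nhds
        ((ψ.continuousAt_symm ht).preimage_mem_nhds (hfin.isClosed.isOpen_compl.mem_nhds
          (by simp : ψ.symm t ∈ ({p | u p = ∞} \ {ψ.symm t})ᶜ)))] with s hs hst hs1 hs2
    simp only [Pi.inv_apply, inftyChart_apply]
    induction h : u (ψ.symm s) using OnePoint.rec with
    | infty => exact absurd ⟨h, fun he => hst (ψ.symm.injOn hs1 ht he)⟩ hs2
    | coe a =>
      have ha : a ≠ 0 := by rintro rfl; exact hs h
      simp [inv_coe_of_ne ha]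
  · exact (hu.analyticAt_coord hψ mdifferentiable_affineChart ht (by simpa using hp)).meromorphicAt

omit hu in
theorem ofHomogeneous_of_ne_zero {a b : ℂ} (hb : b ≠ 0) :
    ofHomogeneous a b = ((a / b : ℂ) : OnePoint ℂ) := if_neg hb

omit hu in
theorem ofHomogeneous_eq_inv {a b : ℂ} (h : a ≠ 0 ∨ b ≠ 0) :
    ofHomogeneous a b = inv (ofHomogeneous b a) := by
  by_cases hb : b = 0
  · have ha : a ≠ 0 := by simpa [hb] using h
    simp [ofHomogeneous, ha, hb]
  · by_cases ha : a = 0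
    · simp [ofHomogeneous, ha, hb]
    · simp [ofHomogeneous, ha, hb, inv_coe_of_ne]

omit hu in
theorem ofHomogeneous_mul {c : ℂ} (hc : c ≠ 0) (a b : ℂ) :
    ofHomogeneous (c * a) (c * b) = ofHomogeneous a b := by
  by_cases hb : b = 0
  · simp [ofHomogeneous, hb]
  · simp [ofHomogeneous, hb, hc, mul_div_mul_left]

omit hu in
theorem continuous_ofHomogeneous {A B : ℂ[X]} (h : ∀ t, A.eval t ≠ 0 ∨ B.eval t ≠ 0) :
    Continuous fun t => ofHomogeneous (A.eval t) (B.eval t) := by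
  have key : ∀ (A B : ℂ[X]) (t : ℂ), B.eval t ≠ 0 →
      ContinuousAt (fun t => ofHomogeneous (A.eval t) (B.eval t)) t := by
    intro A B t ht
    have h1 : ContinuousAt (fun t => ((A.eval t / B.eval t : ℂ) : OnePoint ℂ)) t :=
      OnePoint.continuous_coe.continuousAt.comp (A.continuousAt.div B.continuousAt ht)
    refine h1.congr ?_
    filter_upwards [B.continuousAt.eventually_ne ht] with s hs
    exact (ofHomogeneous_of_ne_zero hs).symm
  rw [continuous_iff_continuousAt]
  intro t
  by_cases hB : B.eval t = 0
  · have h1 := continuous_inv.continuousAt.comp (key B A t (by simpa [hB] using h t))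
    refine h1.congr (Filter.Eventually.of_forall fun s => ?_)
    exact (ofHomogeneous_eq_inv (h s)).symm
  · exact key A B t hB

omit hu in
theorem eval_reflect {P : ℂ[X]} {N : ℕ} (hP : P.natDegree ≤ N) {t : ℂ} (ht : t ≠ 0) :
    (P.reflect N).eval t = t ^ N * P.eval t⁻¹ := by
  let _ : Invertible t⁻¹ := invertibleOfNonzero (inv_ne_zero ht)
  have h := eval₂_reflect_mul_pow (RingHom.id ℂ) t⁻¹ N P hP
  rw [invOf_eq_inv, _root_.inv_inv, eval₂_id, eval₂_id] at h
  rw [← h, inv_pow]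
  field_simp

omit hu in
theorem exists_isCoprime_eq_mul (P₀ Q₀ : ℂ[X]) :
    ∃ P Q G : ℂ[X], IsCoprime P Q ∧ P₀ = G * P ∧ Q₀ = G * Q := by
  classical
  let _ : GCDMonoid ℂ[X] := IsBezout.toGCDDomain _
  obtain ⟨P, Q, hP, hQ, hPQ⟩ := extract_gcd P₀ Q₀
  exact ⟨P, Q, _, (gcd_isUnit_iff P Q).1 hPQ, hP, hQ⟩

/-- The affine coordinate of u is meromorphic on the whole sphere, hence a quotient of polynomials
away from the poles. After cancelling the common factor both sides are continuous, so the identity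
extends over the poles by density. -/
theorem exists_isCoprime_apply_coe (hnonconst : ¬ ∃ y, ∀ x, u x = y) :
    ∃ P Q : ℂ[X], IsCoprime P Q ∧
      ∀ x : ℂ, u (x : OnePoint ℂ) = ofHomogeneous (P.eval x) (Q.eval x) := by
  have hfin := (finite_preimage_infty hu hnonconst).preimage
    (f := ((↑) : ℂ → OnePoint ℂ)) OnePoint.coe_injective.injOn
  obtain ⟨P₀, Q₀, hPQ₀⟩ := exists_eq_polynomial_div
    (f := fun z => affineChart (u (z : OnePoint ℂ))) hfin.toFinset
    (fun z hz => hu.analyticAt_coord mdifferentiable_affineChart mdifferentiable_affineChart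
      (t := z) (by simp) (by simpa using hz))
    (fun z _ => meromorphicAt_affineChart_comp hu hnonconst mdifferentiable_affineChart
      (t := z) (by simp))
    (by
      refine (meromorphicAt_affineChart_comp hu hnonconst mdifferentiable_inftyChart
        (t := 0) (by simp)).congr ?_
      filter_upwards [self_mem_nhdsWithin] with t ht
      rw [inftyChart_symm_apply, inv_coe_of_ne ht])
  obtain ⟨P, Q, G, hc, hPG, hQG⟩ := exists_isCoprime_eq_mul P₀ Q₀
  refine ⟨P, Q, hc, ?_⟩
  refine fun x => congrFun (Continuous.ext_on (hfin.countable.dense_compl ℂ)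
    (hu.continuous.comp OnePoint.continuous_coe)
    (continuous_ofHomogeneous (eval_ne_zero_or hc)) fun z hz => ?_) x
  obtain ⟨h1, h2⟩ := hPQ₀ z (by simpa using hz)
  rw [hQG, eval_mul] at h1
  rw [hPG, hQG, eval_mul, eval_mul, mul_div_mul_left _ _ (left_ne_zero_of_mul h1)] at h2
  rw [ofHomogeneous_of_ne_zero (right_ne_zero_of_mul h1), ← h2]
  have hz' : u (z : OnePoint ℂ) ≠ ∞ := hz
  exact (affineChart.left_inv (by simpa using hz')).symm

/-- Holomorphic self-maps of the sphere are rational. -/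
theorem exists_isRationalMap (hnonconst : ¬ ∃ y, ∀ x, u x = y) :
    ∃ P Q : ℂ[X], IsRationalMap u P Q := by
  obtain ⟨P, Q, hc, hcoe⟩ := exists_isCoprime_apply_coe hu hnonconst
  have hpos : 0 < mapDegree P Q := by
    rw [Nat.pos_iff_ne_zero]
    intro h0
    have hP := eq_C_of_natDegree_le_zero (p := P) (by unfold mapDegree at h0; omega)
    have hQ := eq_C_of_natDegree_le_zero (p := Q) (by unfold mapDegree at h0; omega)
    refine hnonconst ⟨ofHomogeneous (P.coeff 0) (Q.coeff 0), fun x => congrFun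
      (Continuous.ext_on OnePoint.denseRange_coe hu.continuous continuous_const ?_) x⟩
    rintro _ ⟨y, rfl⟩
    have := hcoe y
    rw [hP, hQ, eval_C, eval_C] at this
    exact this
  -- For t ≠ 0 reflection multiplies both homogeneous coordinates by t^d; density of the punctured
  -- plane gives t = 0.
  refine ⟨P, Q, hc, hpos, hcoe, fun t => congrFun (Continuous.ext_on
    ((Set.countable_singleton (0 : ℂ)).dense_compl ℂ)
    (hu.continuous.comp (continuous_inv.comp OnePoint.continuous_coe))
    (continuous_ofHomogeneous (reflect_eval_ne_zero_or hc hpos)) fun s hs => ?_) t⟩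
  have hs0 : s ≠ 0 := hs
  simp only [Function.comp_apply]
  rw [inv_coe_of_ne hs0, hcoe, eval_reflect (N := mapDegree P Q) (le_max_left _ _) hs0,
    eval_reflect (N := mapDegree P Q) (le_max_right _ _) hs0, ofHomogeneous_mul (pow_ne_zero _ hs0)]

end RiemannSphere

/-! ### The ramification index as a vanishing order in arbitrary coordinates. -/

section

variable {S T : Type} [TopologicalSpace S] [ChartedSpace ℂ S] [TopologicalSpace T]
  [ChartedSpace ℂ T]

/-- A change of holomorphic coordinates has order one. -/
theorem analyticOrderAt_coordChange {φ κ : OpenPartialHomeomorph S ℂ}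
    (hφ : φ.MDifferentiable 𝓘(ℂ) 𝓘(ℂ)) (hκ : κ.MDifferentiable 𝓘(ℂ) 𝓘(ℂ)) {p : S}
    (hp : p ∈ φ.source) (hp' : p ∈ κ.source) :
    analyticOrderAt (fun t => φ (κ.symm t) - φ p) (κ p) = 1 := by
  have h1 : AnalyticAt ℂ (fun t => φ (κ.symm t)) (κ p) :=
    mdifferentiable_id.analyticAt_coord hκ hφ (κ.map_source hp') (by simpa [κ.left_inv hp'])
  have h2 : AnalyticAt ℂ (fun t => κ (φ.symm t)) (φ p) :=
    mdifferentiable_id.analyticAt_coord hφ hκ (φ.map_source hp) (by simpa [φ.left_inv hp])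
  -- Orders multiply under composition, and the two inverse transitions compose to the identity, of
  -- order 1.
  have h3 := AnalyticAt.analyticOrderAt_comp (f := fun t => κ (φ.symm t) - κ p)
    (g := fun t => φ (κ.symm t)) (z₀ := κ p) (by rw [κ.left_inv hp']; exact h2.sub analyticAt_const) h1
  have h4 : ((fun t => κ (φ.symm t) - κ p) ∘ fun t => φ (κ.symm t)) =ᶠ[𝓝 (κ p)]
      fun t => t - κ p := by
    filter_upwards [κ.open_target.mem_nhds (κ.map_source hp'),
      (κ.continuousAt_symm (κ.map_source hp')).preimage_mem_nhds
        (by rw [κ.left_inv hp']; exact φ.open_source.mem_nhds hp)] with t ht hts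
    simp only [Function.comp_apply]
    rw [φ.left_inv hts, κ.right_inv ht]
  rw [analyticOrderAt_congr h4] at h3
  have h5 : analyticOrderAt (fun t => t - κ p) (κ p) = 1 := analyticOrderAt_id_sub_const_self
  rw [h5] at h3
  simp only [κ.left_inv hp'] at h3
  exact (mul_eq_one.1 h3.symm).2

/-- The ramification index does not depend on the coordinates. -/
theorem MDifferentiable.analyticOrderAt_coord_eq {f : S → T}
    (hf : MDifferentiable 𝓘(ℂ) 𝓘(ℂ) f) {ψ χ : OpenPartialHomeomorph S ℂ}
    (hψ : ψ.MDifferentiable 𝓘(ℂ) 𝓘(ℂ)) (hχ : χ.MDifferentiable 𝓘(ℂ) 𝓘(ℂ))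
    {φ κ : OpenPartialHomeomorph T ℂ}
    (hφ : φ.MDifferentiable 𝓘(ℂ) 𝓘(ℂ)) (hκ : κ.MDifferentiable 𝓘(ℂ) 𝓘(ℂ)) {p : S}
    (hpψ : p ∈ ψ.source) (hpχ : p ∈ χ.source) (hpφ : f p ∈ φ.source) (hpκ : f p ∈ κ.source) :
    analyticOrderAt (fun t => φ (f (ψ.symm t)) - φ (f p)) (ψ p) =
      analyticOrderAt (fun t => κ (f (χ.symm t)) - κ (f p)) (χ p) := by
  trans analyticOrderAt (fun t => φ (f (χ.symm t)) - φ (f p)) (χ p)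
  · have h3 := AnalyticAt.analyticOrderAt_comp (f := fun t => φ (f (χ.symm t)) - φ (f p))
      (g := fun t => χ (ψ.symm t)) (z₀ := ψ p)
      (by
        rw [ψ.left_inv hpψ]
        exact (hf.analyticAt_coord hχ hφ (χ.map_source hpχ)
          (by rwa [χ.left_inv hpχ])).sub analyticAt_const)
      (mdifferentiable_id.analyticAt_coord hψ hχ (ψ.map_source hpψ) (by simpa [ψ.left_inv hpψ]))
    have h5 := analyticOrderAt_coordChange hχ hψ hpχ hpψ
    simp only [ψ.left_inv hpψ, h5, mul_one] at h3
    rw [← h3]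
    refine analyticOrderAt_congr ?_
    filter_upwards [(ψ.continuousAt_symm (ψ.map_source hpψ)).preimage_mem_nhds
        (by rw [ψ.left_inv hpψ]; exact χ.open_source.mem_nhds hpχ)] with t hts
    simp only [Function.comp_apply]
    rw [χ.left_inv hts]
  · have h3 := AnalyticAt.analyticOrderAt_comp (f := fun t => φ (κ.symm t) - φ (f p))
      (g := fun t => κ (f (χ.symm t))) (z₀ := χ p)
      (by
        rw [χ.left_inv hpχ]
        exact (mdifferentiable_id.analyticAt_coord hκ hφ (κ.map_source hpκ)
          (by simpa [κ.left_inv hpκ])).sub analyticAt_const)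
      (hf.analyticAt_coord hχ hκ (χ.map_source hpχ) (by rwa [χ.left_inv hpχ]))
    have h5 := analyticOrderAt_coordChange hφ hκ hpφ hpκ
    simp only [χ.left_inv hpχ, h5, one_mul] at h3
    rw [← h3]
    refine analyticOrderAt_congr ?_
    have hc : ContinuousAt (fun t => f (χ.symm t)) (χ p) :=
      hf.continuous.continuousAt.comp (χ.continuousAt_symm (χ.map_source hpχ))
    filter_upwards [hc.preimage_mem_nhds
        (by rw [χ.left_inv hpχ]; exact κ.open_source.mem_nhds hpκ)] with t hts
    simp only [Function.comp_apply]
    rw [κ.left_inv hts]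

end

namespace Polynomial

theorem analyticOrderAt_eval {R : ℂ[X]} (hR : R ≠ 0) (t : ℂ) :
    analyticOrderAt (fun z => R.eval z) t = R.rootMultiplicity t := by
  obtain ⟨q, hq, hdvd⟩ := exists_eq_pow_rootMultiplicity_mul_and_not_dvd R hR t
  rw [(R.differentiable.analyticAt t).analyticOrderAt_eq_natCast]
  refine ⟨fun z => q.eval z, q.differentiable.analyticAt t, ?_, Filter.Eventually.of_forall ?_⟩
  · rwa [dvd_iff_isRoot] at hdvd
  · intro z
    conv_lhs => rw [hq]
    simp

theorem analyticOrderAt_eval_div {A B : ℂ[X]} (hA : A ≠ 0) {t : ℂ} (hB : B.eval t ≠ 0) :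
    analyticOrderAt (fun z => A.eval z / B.eval z) t = A.rootMultiplicity t := by
  have h1 : (fun z => A.eval z / B.eval z) = (fun z => A.eval z) * fun z => (B.eval z)⁻¹ := by
    funext z
    exact div_eq_mul_inv _ _
  have hinv : AnalyticAt ℂ (fun z => (B.eval z)⁻¹) t := (B.differentiable.analyticAt t).inv hB
  rw [h1, analyticOrderAt_mul (A.differentiable.analyticAt t) hinv, analyticOrderAt_eval hA,
    hinv.analyticOrderAt_eq_zero.2 (inv_ne_zero hB), add_zero]

theorem rootMultiplicity_zero_reflect {R : ℂ[X]} (hR : R ≠ 0) {N : ℕ} (hN : R.natDegree ≤ N) :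
    (R.reflect N).rootMultiplicity 0 = N - R.natDegree := by
  rw [rootMultiplicity_eq_natTrailingDegree']
  refine le_antisymm (natTrailingDegree_le_of_ne_zero ?_)
    (le_natTrailingDegree (by rwa [Ne, reflect_eq_zero_iff]) fun k hk => ?_)
  · rw [coeff_reflect, revAt_le (Nat.sub_le _ _), Nat.sub_sub_self hN, coeff_natDegree]
    exact leadingCoeff_ne_zero.2 hR
  · rw [coeff_reflect, revAt_le (by omega)]
    exact coeff_eq_zero_of_natDegree_lt (by omega)

end Polynomial

namespace RiemannSphere

open Polynomial

/-- In the chart at w the difference is the fibre polynomial over a denominator that does not vanish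
at t: (A − aB)/B at a finite point a, and B/A at infinity. -/
theorem analyticOrderAt_chartAt_ofHomogeneous {A B : ℂ[X]} {t : ℂ}
    (h : A.eval t ≠ 0 ∨ B.eval t ≠ 0) {w : RiemannSphere}
    (hw : ofHomogeneous (A.eval t) (B.eval t) = w) (h0 : fiberPoly A B w ≠ 0) :
    analyticOrderAt (fun s => chartAt ℂ w (ofHomogeneous (A.eval s) (B.eval s)) - chartAt ℂ w w) t
      = (fiberPoly A B w).rootMultiplicity t := by
  have hroot := (ofHomogeneous_eq_iff h w).1 hw
  induction w using OnePoint.rec with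
  | infty =>
    rw [fiberPoly_infty] at h0 hroot ⊢
    have hA : A.eval t ≠ 0 := by simpa [hroot] using h
    rw [← analyticOrderAt_eval_div h0 hA]
    refine analyticOrderAt_congr ?_
    filter_upwards [A.continuousAt.eventually_ne hA] with s hs
    rw [chartAt_infty, inftyChart_apply, inftyChart_apply, inv_infty, affineChart_coe, sub_zero,
      ofHomogeneous_eq_inv (Or.inl hs), inv_inv, ofHomogeneous_of_ne_zero hs, affineChart_coe]
  | coe a =>
    rw [fiberPoly_coe] at h0 hroot ⊢
    have hB : B.eval t ≠ 0 := by
      intro hB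
      simp [hB] at hroot
      simp [hB, hroot] at h
    rw [← analyticOrderAt_eval_div h0 hB]
    refine analyticOrderAt_congr ?_
    filter_upwards [B.continuousAt.eventually_ne hB] with s hs
    rw [chartAt_coe, ofHomogeneous_of_ne_zero hs, affineChart_coe, affineChart_coe]
    simp
    field_simp

theorem IsRationalMap.analyticOrderAt_coord {u : RiemannSphere → RiemannSphere} {P Q : ℂ[X]}
    (h : IsRationalMap u P Q) (hu : MDifferentiable 𝓘(ℂ) 𝓘(ℂ) u) (p : RiemannSphere)
    {ψ φ : OpenPartialHomeomorph RiemannSphere ℂ} (hψ : ψ.MDifferentiable 𝓘(ℂ) 𝓘(ℂ))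
    (hφ : φ.MDifferentiable 𝓘(ℂ) 𝓘(ℂ)) (hp : p ∈ ψ.source) (hup : u p ∈ φ.source) :
    analyticOrderAt (fun t => φ (u (ψ.symm t)) - φ (u p)) (ψ p) = ramification u P Q p := by
  have : IsManifold 𝓘(ℂ) 1 RiemannSphere := IsManifold.of_le (n := ⊤) le_top
  rw [hu.analyticOrderAt_coord_eq hψ (mdifferentiable_chart (I := 𝓘(ℂ)) p) hφ
    (mdifferentiable_chart (I := 𝓘(ℂ)) (u p)) hp (mem_chart_source ℂ p) hup
    (mem_chart_source ℂ (u p))]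
  induction p using OnePoint.rec with
  | infty =>
    have h1 := analyticOrderAt_chartAt_ofHomogeneous (t := 0)
      (reflect_eval_ne_zero_or h.coprime h.pos 0) (w := u ∞)
      (by rw [← h.apply_inv, inv_zero])
      (by rw [fiberPoly_reflect, Ne, reflect_eq_zero_iff]; exact h.fiberPoly_ne_zero _)
    rw [fiberPoly_reflect, rootMultiplicity_zero_reflect (h.fiberPoly_ne_zero _)
      (natDegree_fiberPoly_le P Q _)] at h1
    rw [ramification_infty, ← h1, chartAt_infty, inftyChart_apply, inv_infty, affineChart_coe]
    simp only [inftyChart_symm_apply, h.apply_inv]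
  | coe x =>
    rw [ramification_coe, ← analyticOrderAt_chartAt_ofHomogeneous (eval_ne_zero_or h.coprime x)
      (h.apply_coe x).symm (h.fiberPoly_ne_zero _), chartAt_coe, affineChart_coe]
    simp only [affineChart_symm_apply, h.apply_coe]

end RiemannSphere

/-! ### Local normal form and construction of uniformizing charts. -/

/-- A holomorphic germ with nonzero derivative restricts to a holomorphic coordinate. -/
theorem AnalyticAt.exists_openPartialHomeomorph {h : ℂ → ℂ} {a : ℂ} (ha : AnalyticAt ℂ h a)
    (hd : deriv h a ≠ 0) {W : Set ℂ} (hW : W ∈ 𝓝 a) :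
    ∃ H : OpenPartialHomeomorph ℂ ℂ, H.MDifferentiable 𝓘(ℂ) 𝓘(ℂ) ∧ a ∈ H.source ∧
      H.source ⊆ W ∧ ∀ t, H t = h t := by
  have hf : HasFDerivAt h
      ((ContinuousLinearEquiv.unitsEquivAut ℂ (Units.mk0 _ hd) : ℂ ≃L[ℂ] ℂ) : ℂ →L[ℂ] ℂ) a :=
    ha.differentiableAt.hasDerivAt.hasFDerivAt_equiv hd
  have hc : ContDiffAt ℂ 1 h a := ha.contDiffAt
  let H₀ := hc.toOpenPartialHomeomorph h hf one_ne_zero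
  have hH₀ : a ∈ H₀.source := hc.mem_toOpenPartialHomeomorph_source hf one_ne_zero
  have hev : ∀ᶠ t in 𝓝 a, AnalyticAt ℂ h t ∧ deriv h t ≠ 0 ∧ t ∈ W :=
    ha.eventually_analyticAt.and ((ha.deriv.continuousAt.eventually_ne hd).and hW)
  -- The derivative must be nonzero on all of V for the inverse to be holomorphic on the whole
  -- target, not only at the image of a.
  obtain ⟨V, hV, hVo, haV⟩ := eventually_nhds_iff.1 hev
  have hcoe : ∀ t, H₀.restrOpen V hVo t = h t := fun t => rfl
  have hsrc : (H₀.restrOpen V hVo).source = H₀.source ∩ V := rfl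
  refine ⟨H₀.restrOpen V hVo, ⟨?_, ?_⟩, ⟨hH₀, haV⟩, fun t ht => (hV t ht.2).2.2, hcoe⟩
  · rw [mdifferentiableOn_iff_differentiableOn]
    intro t ht
    exact (hV t ht.2).1.differentiableAt.differentiableWithinAt
  · rw [mdifferentiableOn_iff_differentiableOn]
    intro s hs
    have hs' := (H₀.restrOpen V hVo).map_target hs
    obtain ⟨h1, h2, -⟩ := hV _ hs'.2
    have h3 : ContDiffAt ℂ 1 (H₀.restrOpen V hVo).symm s :=
      (H₀.restrOpen V hVo).contDiffAt_symm_deriv h2 hs h1.differentiableAt.hasDerivAt h1.contDiffAt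
    exact (h3.differentiableAt one_ne_zero).differentiableWithinAt

/-- A holomorphic germ vanishing to order `k` is the `k`-th power of a local coordinate. -/
theorem AnalyticAt.exists_pow_eq {G : ℂ → ℂ} (hG : AnalyticAt ℂ G 0) {k : ℕ} (hk : k ≠ 0)
    (hord : analyticOrderAt G 0 = k) :
    ∃ h : ℂ → ℂ, AnalyticAt ℂ h 0 ∧ h 0 = 0 ∧ deriv h 0 ≠ 0 ∧ ∀ᶠ t in 𝓝 0, h t ^ k = G t := by
  obtain ⟨g, hg, hg0, hGg⟩ := hG.analyticOrderAt_eq_natCast.1 hord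
  obtain ⟨α, hα⟩ := IsAlgClosed.exists_pow_nat_eq (g 0) (Nat.pos_of_ne_zero hk)
  have hα0 : α ≠ 0 := by
    rintro rfl
    exact hg0 (by rw [← hα, zero_pow hk])
  -- An analytic k-th root of the unit g: dividing by g(0) keeps the argument of the logarithm near
  -- 1, away from the branch cut.
  let ρ : ℂ → ℂ := fun t => α * Complex.exp (Complex.log (g t / g 0) / k)
  have hρ : AnalyticAt ℂ ρ 0 := by
    refine analyticAt_const.mul (AnalyticAt.cexp (AnalyticAt.div ?_ analyticAt_const
      (Nat.cast_ne_zero.2 hk)))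
    refine (hg.div analyticAt_const hg0).clog ?_
    simp [div_self hg0]
  have hρ0 : ρ 0 = α := by simp [ρ, div_self hg0]
  have hder : HasDerivAt (fun t => t * ρ t) α 0 := by
    have := (hasDerivAt_id (0 : ℂ)).mul hρ.differentiableAt.hasDerivAt
    rwa [id, one_mul, zero_mul, add_zero, hρ0] at this
  refine ⟨fun t => t * ρ t, analyticAt_id.mul hρ, zero_mul _, by rwa [hder.deriv], ?_⟩
  filter_upwards [hGg, hg.continuousAt.eventually_ne hg0] with t ht hgt
  have h1 : Complex.exp (Complex.log (g t / g 0) / k) ^ k = g t / g 0 := by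
    rw [← Complex.exp_nat_mul, mul_div_cancel₀ _ (Nat.cast_ne_zero.2 hk),
      Complex.exp_log (div_ne_zero hgt hg0)]
  rw [ht]
  simp only [ρ, mul_pow, h1, hα, sub_zero, smul_eq_mul]
  field_simp

namespace OrbiSurface

variable {S T : Type} [TopologicalSpace S] [ChartedSpace ℂ S] [TopologicalSpace T]
  [ChartedSpace ℂ T]

/-- The chart of given radius cut out of a centred coordinate. -/
theorem exists_chart (X : OrbiSurface S) {p : S} {φ : OpenPartialHomeomorph S ℂ}
    (hφ : φ.MDifferentiable 𝓘(ℂ) 𝓘(ℂ)) (hp : p ∈ φ.source) (h0 : φ p = 0) {r : ℝ} (hr : 0 < r)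
    (hball : Metric.ball 0 (r ^ X.order p) ⊆ φ.target)
    (hsing : ∀ q ∈ φ.source, q ≠ p → X.order q = 1) :
    ∃ c : X.Chart p, c.radius = r ∧ ∀ s, c.coord.symm s = φ.symm s := by
  let φ' := (φ.symm.restrOpen (Metric.ball 0 (r ^ X.order p)) Metric.isOpen_ball).symm
  have hsrc : φ'.source ⊆ φ.source := fun q hq => hq.1
  have htgt : φ'.target = φ.target ∩ Metric.ball 0 (r ^ X.order p) := rfl
  refine ⟨⟨r, hr, φ', ⟨?_, ?_⟩, ?_, h0, ?_, fun q hq => hsing q (hsrc hq)⟩, rfl, fun s => rfl⟩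
  · exact hφ.1.mono hsrc
  · exact hφ.2.mono (htgt ▸ Set.inter_subset_left)
  · refine ⟨hp, ?_⟩
    simp [h0, pow_pos hr]
  · rw [htgt, Set.inter_eq_right.2 hball]

/-- If the ramification of `f` at `x` accounts for the quotient of the orders of the isotropy
groups, then `f` is a natural projection in suitable uniformizing charts. -/
theorem exists_chart_eq_proj {X : OrbiSurface S} {Y : OrbiSurface T} {f : S → T}
    (hf : MDifferentiable 𝓘(ℂ) 𝓘(ℂ) f) {x : S} {y : T} (hy : f x = y) (b : X.Chart x)
    (c : Y.Chart y) {k : ℕ} (hkm : k * X.order x = Y.order y)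
    (hk : analyticOrderAt (fun t => c.coord (f (b.coord.symm t))) 0 = k) :
    ∃ ρ : ℝ, 0 < ρ ∧ ∀ r, 0 < r → r ≤ ρ → ∃ c' : X.Chart x, c'.radius = r ∧
      ∀ v ∈ c'.disc, f (c'.proj v) = c.coord.symm (v ^ Y.order y) := by
  subst hy
  have hk0 : k ≠ 0 := by
    rintro rfl
    exact (Y.order_pos (f x)).ne' (by rw [← hkm, zero_mul])
  have h0t : (0 : ℂ) ∈ b.coord.target := b.coord_center ▸ b.coord.map_source b.mem_source
  have hx : b.coord.symm 0 = x := by rw [← b.coord_center, b.coord.left_inv b.mem_source]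
  have hc : ContinuousAt (fun t => f (b.coord.symm t)) 0 :=
    hf.continuous.continuousAt.comp (b.coord.continuousAt_symm h0t)
  have hfx : f (b.coord.symm 0) ∈ c.coord.source := by rw [hx]; exact c.mem_source
  obtain ⟨h, hh, hh0, hhd, hhG⟩ :=
    (hf.analyticAt_coord b.holomorphic c.holomorphic h0t hfx).exists_pow_eq hk0 hk
  obtain ⟨H, hHd, hH0, hHW, hHh⟩ := hh.exists_openPartialHomeomorph hhd
    (hhG.and (hc.preimage_mem_nhds (c.coord.open_source.mem_nhds hfx)))
  -- In this coordinate the local expression of f is exactly s ↦ s^k.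
  let ψ := b.coord.trans H
  have hψx : x ∈ ψ.source := by
    refine ⟨b.mem_source, ?_⟩
    change b.coord x ∈ H.source
    rwa [b.coord_center]
  have hψ0 : ψ x = 0 := by
    change H (b.coord x) = 0
    rw [b.coord_center, hHh, hh0]
  have hψsrc : ψ.source ⊆ b.coord.source := fun q hq => hq.1
  obtain ⟨δ, hδ, hball⟩ := Metric.isOpen_iff.1 ψ.open_target 0 (hψ0 ▸ ψ.map_source hψx)
  -- The bound by 1 makes r^m ≤ r ≤ δ, so every smaller radius is allowed as well; this is what lets
  -- radii be matched across a fibre.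
  refine ⟨min 1 δ, lt_min one_pos hδ, fun r hr hrδ => ?_⟩
  have hrm : r ^ X.order x ≤ δ := by
    refine (pow_le_of_le_one hr.le (hrδ.trans (min_le_left _ _)) (X.order_pos x).ne').trans ?_
    exact hrδ.trans (min_le_right _ _)
  obtain ⟨c', hc'r, hc's⟩ := X.exists_chart (b.holomorphic.trans hHd) hψx hψ0 hr
    ((Metric.ball_subset_ball hrm).trans hball) fun q hq => b.order_eq_one q (hψsrc hq)
  refine ⟨c', hc'r, fun v hv => ?_⟩
  have hvm : v ^ X.order x ∈ ψ.target := by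
    refine hball (Metric.ball_subset_ball hrm ?_)
    have hv' : ‖v‖ < r := by simpa [Chart.disc, hc'r] using hv
    rw [mem_ball_zero_iff, norm_pow]
    exact pow_lt_pow_left₀ hv' (norm_nonneg _) (X.order_pos x).ne'
  set s := v ^ X.order x with hs
  have hsH : s ∈ H.target := hvm.1
  obtain ⟨h1, h2⟩ := hHW (H.map_target hsH)
  rw [← hHh, H.right_inv hsH] at h1
  have h3 : c'.proj v = b.coord.symm (H.symm s) := hc's s
  have h4 : v ^ Y.order (f x) = s ^ k := by rw [hs, ← pow_mul, mul_comm, hkm]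
  rw [h3, h4, h1, c.coord.left_inv h2]

end OrbiSurface

/-! ### Constraints imposed by local lifts and by ages. -/

namespace OrbiSurface

theorem isPrimitiveRoot_generator {S : Type} (X : OrbiSurface S) (p : S) :
    IsPrimitiveRoot (X.generator p) (X.order p) := by
  rw [← IsPrimitiveRoot.coe_submonoidClass_iff, ← IsPrimitiveRoot.coe_units_iff, generator_coe]
  exact Complex.isPrimitiveRoot_exp _ (X.order_pos p).ne'

end OrbiSurface

section

variable {S T : Type} [TopologicalSpace S] [ChartedSpace ℂ S] [TopologicalSpace T]
  [ChartedSpace ℂ T] {X : OrbiSurface S} {Y : OrbiSurface T} {f : S → T} {p : S}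

namespace LocalLift

variable (L : LocalLift X Y f p)
include L

theorem isPrimitiveRoot_hom_generator :
    IsPrimitiveRoot ((L.hom (X.generator p) : ℂˣ) : ℂ) (X.order p) := by
  rw [IsPrimitiveRoot.coe_units_iff, IsPrimitiveRoot.coe_submonoidClass_iff]
  exact (X.isPrimitiveRoot_generator p).map_of_injective L.hom_injective

theorem order_dvd : X.order p ∣ Y.order (f p) := by
  refine L.isPrimitiveRoot_hom_generator.dvd_of_pow_eq_one _ ?_
  exact (mem_rootsOfUnity' _ _).1 (L.hom (X.generator p)).2

theorem isotropy_le : X.isotropy p ≤ Y.isotropy (f p) := rootsOfUnity_le_of_dvd L.order_dvd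

/-- The ramification index at `p`, times the order at `p`, is a multiple of the order at `f p`. -/
theorem exists_order_mul_eq (hf : MDifferentiable 𝓘(ℂ) 𝓘(ℂ) f) {e : ℕ}
    (he : analyticOrderAt (fun t => L.target.coord (f (L.source.coord.symm t))) 0 = e) :
    ∃ k : ℕ, Y.order (f p) * k = e * X.order p := by
  have h0t : (0 : ℂ) ∈ L.source.coord.target :=
    L.source.coord_center ▸ L.source.coord.map_source L.source.mem_source
  have hm := (X.order_pos p).ne'
  have hp : L.source.coord.symm 0 = p := by
    rw [← L.source.coord_center, L.source.coord.left_inv L.source.mem_source]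
  have hdisc : L.source.disc ∈ 𝓝 (0 : ℂ) := Metric.ball_mem_nhds _ L.source.radius_pos
  have hlift : AnalyticAt ℂ L.lift 0 := L.lift_holomorphic.analyticAt hdisc
  have hG := hf.analyticAt_coord L.source.holomorphic L.target.holomorphic h0t
    (by rw [hp]; exact L.target.mem_source)
  have h1 := AnalyticAt.analyticOrderAt_comp
    (f := fun t => L.target.coord (f (L.source.coord.symm t)))
    (g := fun v : ℂ => v ^ X.order p) (z₀ := 0) (by rwa [zero_pow hm]) (analyticAt_id.pow _)
  have h2 : analyticOrderAt (fun v : ℂ => v ^ X.order p - 0 ^ X.order p) 0 = X.order p := by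
    have := analyticOrderAt_centeredMonomial (𝕜 := ℂ) (z₀ := 0) (n := X.order p)
    rw [← this]
    refine analyticOrderAt_congr (Filter.Eventually.of_forall fun v => ?_)
    simp [zero_pow hm]
  -- This is G(v^m) = lift(v)^n; taking orders at 0 gives e·m = n·k, with k the order of the lift.
  have h3 : ((fun t => L.target.coord (f (L.source.coord.symm t))) ∘
      fun v : ℂ => v ^ X.order p) =ᶠ[𝓝 0] L.lift ^ Y.order (f p) := by
    filter_upwards [hdisc] with v hv
    have hv' : ‖L.lift v‖ < L.target.radius := by
      simpa [OrbiSurface.Chart.disc] using L.lift_mapsTo hv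
    have hmem : L.lift v ^ Y.order (f p) ∈ L.target.coord.target := by
      rw [L.target.target_eq, mem_ball_zero_iff, norm_pow]
      exact pow_lt_pow_left₀ hv' (norm_nonneg _) (Y.order_pos (f p)).ne'
    have h4 := congrArg L.target.coord (L.proj_lift v hv)
    rw [OrbiSurface.Chart.proj, L.target.coord.right_inv hmem] at h4
    exact h4.symm
  rw [analyticOrderAt_congr h3, analyticOrderAt_pow hlift, h2, zero_pow hm, he] at h1
  have hN : Y.order (f p) ≠ 0 := (Y.order_pos (f p)).ne'
  cases hl : analyticOrderAt L.lift 0 with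
  | top =>
    rw [hl, nsmul_eq_mul, ENat.mul_top (by exact_mod_cast hN)] at h1
    exact absurd h1.symm (by rw [← Nat.cast_mul]; exact ENat.natCast_ne_top _)
  | coe k =>
    rw [hl, nsmul_eq_mul] at h1
    exact ⟨k, by exact_mod_cast h1⟩

end LocalLift

end

/-- A root of unity has modulus 1, so its argument determines it; taking the fractional part changes
the exponent by a multiple of 2πi. -/
theorem TwistedSector.exp_age {T : Type} {Y : OrbiSurface T} (s : TwistedSector Y) :
    Complex.exp (2 * Real.pi * Complex.I * s.age) = ((s.elt : ℂˣ) : ℂ) := by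
  set g : ℂ := ((s.elt : ℂˣ) : ℂ) with hg
  have hpow : g ^ Y.order s.point = 1 := (mem_rootsOfUnity' _ _).1 s.elt.2
  have hnorm : ‖g‖ = 1 := Complex.norm_eq_one_of_pow_eq_one hpow (Y.order_pos _).ne'
  have hage : (s.age : ℂ) = Complex.arg g / (2 * Real.pi) -
      (⌊Complex.arg g / (2 * Real.pi)⌋ : ℤ) := by
    rw [TwistedSector.age, ← Int.self_sub_floor]
    push_cast
    rfl
  have hpi : (Real.pi : ℂ) ≠ 0 := by exact_mod_cast Real.pi_ne_zero
  have harg : 2 * Real.pi * Complex.I * s.age = Complex.arg g * Complex.I -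
      (⌊Complex.arg g / (2 * Real.pi)⌋ : ℤ) * (2 * Real.pi * Complex.I) := by
    rw [hage]
    field_simp
  rw [harg, Complex.exp_sub, Complex.exp_int_mul_two_pi_mul_I, div_one]
  have := Complex.norm_mul_exp_arg_mul_I g
  rwa [hnorm, Complex.ofReal_one, one_mul] at this

/-- If the inverse of the age is an integer, this integer is the order of the group element. -/
theorem TwistedSector.age_eq_one_div {T : Type} {Y : OrbiSurface T} (s : TwistedSector Y) {k : ℤ} (hk : (s.age)⁻¹ = k) {m : ℕ}
    (hm : IsPrimitiveRoot ((s.elt : ℂˣ) : ℂ) m) : s.age = 1 / m := by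
  have h0 : 0 ≤ s.age := Int.fract_nonneg _
  have hne : s.age ≠ 0 := by
    intro h
    have := s.exp_age
    rw [h, Complex.ofReal_zero, mul_zero, Complex.exp_zero] at this
    exact s.elt_ne_one (by ext; simpa using this.symm)
  have hkpos : 0 < k := by
    have : 0 < (s.age)⁻¹ := inv_pos.2 (lt_of_le_of_ne h0 hne.symm)
    rw [hk] at this
    exact_mod_cast this
  lift k to ℕ using hkpos.le
  have hage : s.age = 1 / (k : ℝ) := by
    rw [← _root_.inv_inv s.age, hk, one_div]
    simp
  have hexp := s.exp_age
  rw [hage] at hexp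
  have hroot := Complex.isPrimitiveRoot_exp k (by exact_mod_cast hkpos.ne')
  have : Complex.exp (2 * Real.pi * Complex.I / k) = ((s.elt : ℂˣ) : ℂ) := by
    rw [← hexp]
    congr 1
    push_cast
    ring
  rw [this] at hroot
  rw [hage, hroot.unique hm]

/-! ### Equality in the orbifold Riemann-Hurwitz formula. -/

namespace RiemannSphere

/-- This turns sums over points of the sphere into sums over marked points; distinctness leaves at
most one nonzero summand. -/
theorem one_sub_one_div_order {k : ℕ} {z : Fin k → RiemannSphere} (hz : Function.Injective z)
    (m : Fin k → ℕ) (hm : ∀ i, 1 ≤ m i) [DecidableEq RiemannSphere] (p : RiemannSphere) :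
    (1 : ℝ) - 1 / (orbiSphere z m hm).order p = ∑ i, if z i = p then (1 : ℝ) - 1 / m i else 0 := by
  by_cases hp : ∃ i, z i = p
  · obtain ⟨i, rfl⟩ := hp
    rw [orbiSphere_order_apply hz]
    simp [hz.eq_iff]
  · push Not at hp
    rw [orbiSphere_order_of_notMem m hm hp]
    simp [hp]

/-- Equality in the orbifold Riemann-Hurwitz formula for vanishing Euler characteristics. -/
theorem IsRationalMap.ramification_mul_order_eq {u : RiemannSphere → RiemannSphere}
    {P Q : Polynomial ℂ} (h : IsRationalMap u P Q)
    {z w : Fin 3 → RiemannSphere} (hz : Function.Injective z) (hw : Function.Injective w)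
    {m n : Fin 3 → ℕ} (hm : ∀ i, 1 ≤ m i) (hn : ∀ i, 1 ≤ n i)
    (hmsum : ∑ i, (1 : ℝ) / m i = 1) (hnsum : ∑ i, (1 : ℝ) / n i = 1)
    (hdvd : ∀ p, ∃ k : ℕ, (orbiSphere w n hn).order (u p) * k =
      ramification u P Q p * (orbiSphere z m hm).order p) (p : RiemannSphere) :
    ramification u P Q p * (orbiSphere z m hm).order p = (orbiSphere w n hn).order (u p) := by
  classical
  set X := orbiSphere z m hm
  set Y := orbiSphere w n hn
  set e : RiemannSphere → ℕ := ramification u P Q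
  choose F hFmem hFsum using h.sum_ramification_fiber
  -- Including all marked points and the full fibres over the cone points makes the sums below
  -- complete; p is added so that the conclusion applies to it.
  let S : Finset RiemannSphere :=
    insert p (Finset.univ.image z ∪ Finset.univ.biUnion fun j => F (w j))
  have hpos : ∀ q, (0 : ℝ) ≤ e q / Y.order (u q) - 1 / X.order q := by
    intro q
    obtain ⟨k, hk⟩ := hdvd q
    have hX : (0 : ℝ) < X.order q := by exact_mod_cast X.order_pos q
    have hY : (0 : ℝ) < Y.order (u q) := by exact_mod_cast Y.order_pos (u q)
    have he : 1 ≤ e q := h.one_le_ramification q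
    have hk1 : 1 ≤ k := by
      rw [Nat.one_le_iff_ne_zero]
      rintro rfl
      have := Nat.mul_pos he (X.order_pos q)
      simp only [mul_zero] at hk
      omega
    have hle : Y.order (u q) ≤ e q * X.order q := hk ▸ Nat.le_mul_of_pos_right _ hk1
    rw [sub_nonneg, div_le_div_iff₀ hX hY, one_mul]
    exact_mod_cast hle
  -- Each fibre has d points with multiplicity, so the sum is d·Σ(1 − 1/n_j) = d·(3 − 1).
  have hsum1 : ∑ q ∈ S, (e q : ℝ) * (1 - 1 / Y.order (u q)) = 2 * mapDegree P Q := by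
    have h1 : ∀ q, (e q : ℝ) * (1 - 1 / Y.order (u q)) =
        ∑ j, if w j = u q then (e q : ℝ) * (1 - 1 / n j) else 0 := by
      intro q
      rw [one_sub_one_div_order hw n hn, Finset.mul_sum]
      exact Finset.sum_congr rfl fun j _ => by rw [mul_ite, mul_zero]
    have h2 : ∀ j, ∑ q ∈ S, (if w j = u q then (e q : ℝ) * (1 - 1 / n j) else 0) =
        mapDegree P Q * (1 - 1 / n j) := by
      intro j
      rw [← Finset.sum_filter, ← Finset.sum_mul, ← hFsum (w j), Nat.cast_sum]
      congr 2
      ext q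
      simp only [Finset.mem_filter, hFmem]
      constructor
      · exact fun hq => hq.2.symm
      · refine fun hq => ⟨?_, hq.symm⟩
        simp only [S, Finset.mem_insert, Finset.mem_union, Finset.mem_biUnion]
        exact Or.inr (Or.inr ⟨j, Finset.mem_univ _, (hFmem _ _).2 hq⟩)
    rw [Finset.sum_congr rfl fun q _ => h1 q, Finset.sum_comm, Finset.sum_congr rfl fun j _ => h2 j,
      ← Finset.mul_sum, Finset.sum_sub_distrib, hnsum]
    simp
    ring
  have hsum2 : ∑ q ∈ S, ((1 : ℝ) - 1 / X.order q) = 2 := by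
    rw [Finset.sum_congr rfl fun q _ => one_sub_one_div_order hz m hm q, Finset.sum_comm]
    have h2 : ∀ i, ∑ q ∈ S, (if z i = q then (1 : ℝ) - 1 / m i else 0) = 1 - 1 / m i := by
      intro i
      rw [Finset.sum_ite_eq, if_pos]
      simp [S]
    rw [Finset.sum_congr rfl fun i _ => h2 i, Finset.sum_sub_distrib, hmsum]
    simp
    norm_num
  have hsum3 : ∑ q ∈ S, ((e q : ℝ) - 1) + 2 ≤ 2 * mapDegree P Q := by
    have h1 := h.sum_ramification_sub_one_le S
    have h2 : ∑ q ∈ S, ((e q : ℝ) - 1) = ((∑ q ∈ S, (e q - 1) : ℕ) : ℝ) := by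
      rw [Nat.cast_sum]
      exact Finset.sum_congr rfl fun q _ => by
        rw [Nat.cast_sub (h.one_le_ramification q), Nat.cast_one]
    rw [h2]
    exact_mod_cast h1
  have hle : ∑ q ∈ S, ((e q : ℝ) / Y.order (u q) - 1 / X.order q) ≤ 0 := by
    have : ∑ q ∈ S, ((e q : ℝ) / Y.order (u q) - 1 / X.order q) = ∑ q ∈ S, ((e q : ℝ) - 1) -
        ∑ q ∈ S, (e q : ℝ) * (1 - 1 / Y.order (u q)) + ∑ q ∈ S, ((1 : ℝ) - 1 / X.order q) := by
      rw [← Finset.sum_sub_distrib, ← Finset.sum_add_distrib]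
      exact Finset.sum_congr rfl fun q _ => by ring
    linarith
  have hzero := (Finset.sum_eq_zero_iff_of_nonneg fun q _ => hpos q).1
    (le_antisymm hle (Finset.sum_nonneg fun q _ => hpos q)) p (Finset.mem_insert_self _ _)
  have hX : (X.order p : ℝ) ≠ 0 := by exact_mod_cast (X.order_pos p).ne'
  have hY : (Y.order (u p) : ℝ) ≠ 0 := by exact_mod_cast (Y.order_pos (u p)).ne'
  rw [sub_eq_zero, div_eq_div_iff hY hX, one_mul] at hzero
  exact_mod_cast hzero

end RiemannSphere

end

/-! ### The covering property. -/

/-- A non-constant holomorphic orbifold map from an orbi-sphere with three marked points to an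
elliptic orbi-sphere, whose insertions at the marked points are twisted sectors of total age `1`
with ages of integral inverse, is an orbifold covering. -/
theorem lemma4p2
    (w : Fin 3 → RiemannSphere) (hw : Function.Injective w)
    (n : Fin 3 → ℕ) (hn : ∀ i, 1 ≤ n i) (hell : ∑ i, (1 : ℚ) / (n i : ℚ) = 1)
    (z : Fin 3 → RiemannSphere) (hz : Function.Injective z)
    (m : Fin 3 → ℕ) (hm : ∀ i, 1 ≤ m i)
    (u : RiemannSphere → RiemannSphere)
    (hu : IsHolomorphicOrbiMap (orbiSphere z m hm) (orbiSphere w n hn) u)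
    (hnonconst : ¬ ∃ y, ∀ x, u x = y)
    (s : Fin 3 → TwistedSector (orbiSphere w n hn))
    (hs : ∀ i, HasInsertion (orbiSphere z m hm) (orbiSphere w n hn) u (z i) (s i))
    (hage : ∑ i, (s i).age = 1)
    (hint : ∀ i, ∃ k : ℤ, ((s i).age)⁻¹ = (k : ℝ)) :
    IsOrbifoldCovering (orbiSphere z m hm) (orbiSphere w n hn) u := by
  obtain ⟨hd, hlift⟩ := hu
  obtain ⟨P, Q, h⟩ := RiemannSphere.exists_isRationalMap hd hnonconst
  have hage' : ∀ i, (s i).age = 1 / m i := by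
    intro i
    obtain ⟨-, L, hL⟩ := hs i
    obtain ⟨k, hk⟩ := hint i
    have hprim := L.isPrimitiveRoot_hom_generator
    rw [hL, orbiSphere_order_apply hz] at hprim
    exact (s i).age_eq_one_div hk hprim
  have hmsum : ∑ i, (1 : ℝ) / m i = 1 := by
    rw [← Finset.sum_congr rfl fun i _ => hage' i, hage]
  have hnsum : ∑ i, (1 : ℝ) / n i = 1 := by
    simpa using congrArg ((↑) : ℚ → ℝ) hell
  have hord : ∀ (p : RiemannSphere) (b : (orbiSphere z m hm).Chart p)
      (c : (orbiSphere w n hn).Chart (u p)),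
      analyticOrderAt (fun t => c.coord (u (b.coord.symm t))) 0 =
        RiemannSphere.ramification u P Q p := by
    intro p b c
    have := h.analyticOrderAt_coord hd p b.holomorphic c.holomorphic b.mem_source c.mem_source
    simpa only [b.coord_center, c.coord_center, sub_zero] using this
  have heq := h.ramification_mul_order_eq hz hw hm hn hmsum hnsum fun p =>
    (hlift p).some.exists_order_mul_eq hd (hord p _ _)
  have hsurj : Function.Surjective u := by
    intro y
    obtain ⟨F, hF, hsum⟩ := h.sum_ramification_fiber y
    have hne : F.Nonempty := by
      rw [Finset.nonempty_iff_ne_empty]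
      rintro rfl
      have := h.pos
      rw [← hsum] at this
      exact absurd this (lt_irrefl _)
    obtain ⟨p, hp⟩ := hne
    exact ⟨p, (hF p).1 hp⟩
  refine ⟨hd.continuous, hsurj, fun y => ?_⟩
  obtain ⟨F, hF, -⟩ := h.sum_ramification_fiber y
  -- By surjectivity, a local lift at some preimage supplies a chart around y.
  obtain ⟨c₀⟩ : Nonempty ((orbiSphere w n hn).Chart y) := by
    obtain ⟨p, rfl⟩ := hsurj y
    exact ⟨(hlift p).some.target⟩
  have hloc : ∀ x, u x = y → ∃ ρ : ℝ, 0 < ρ ∧ ∀ r, 0 < r → r ≤ ρ →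
      ∃ c' : (orbiSphere z m hm).Chart x, c'.radius = r ∧
        ∀ v ∈ c'.disc, u (c'.proj v) = c₀.coord.symm (v ^ (orbiSphere w n hn).order y) := by
    rintro x rfl
    exact OrbiSurface.exists_chart_eq_proj hd rfl (hlift x).some.source c₀ (heq x) (hord x _ _)
  choose! ρ hρ0 hρ using hloc
  -- A common radius exists because the fibre is finite.
  obtain ⟨r, hr, hrc, hrρ⟩ : ∃ r : ℝ, 0 < r ∧ r ≤ c₀.radius ∧ ∀ x, u x = y → r ≤ ρ x := by
    have hev : ∀ᶠ r in 𝓝[>] (0 : ℝ), r ≤ c₀.radius ∧ ∀ x ∈ F, r ≤ ρ x := by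
      refine Filter.Eventually.filter_mono nhdsWithin_le_nhds
        ((eventually_le_nhds c₀.radius_pos).and
          ((Filter.eventually_all_finset F).2 fun x hx => ?_))
      exact eventually_le_nhds (hρ0 x ((hF x).1 hx))
    obtain ⟨r, ⟨h1, h2⟩, h3⟩ := (hev.and self_mem_nhdsWithin).exists
    exact ⟨r, h3, h1, fun x hx => h2 x ((hF x).2 hx)⟩
  obtain ⟨c, hcr, hcs⟩ := (orbiSphere w n hn).exists_chart c₀.holomorphic c₀.mem_source
    c₀.coord_center hr (by
      rw [c₀.target_eq]
      exact Metric.ball_subset_ball (pow_le_pow_left₀ hr.le hrc _)) c₀.order_eq_one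
  refine ⟨c, fun x hx => ⟨?_, ?_⟩⟩
  · subst hx
    exact (hlift x).some.isotropy_le
  · obtain ⟨c', hc'r, hc'⟩ := hρ x hx r hr (hrρ x hx)
    refine ⟨c', hc'r.trans hcr.symm, fun v hv => ?_⟩
    rw [hc' v hv]
    exact (hcs _).symm
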